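/- Let $A=\{0,\dots,n-1\}$ be a finite alphabet, and let $\varphi\colon A^*\to A^*$ be a morphism, i.e. $\varphi(uv)=\varphi(u)\varphi(v)$ for all words $u,v$. It is non-erasing if $\varphi(b)$ is nonempty for every $b\in A$. It is prolongable on a letter $s\in A$ if $\varphi(s)=su$ for a word $u$ such that $\varphi^m(u)$ is nonempty for all $m\ge 0$; then $\varphi^\infty(s)=\lim_{m\to\infty}\varphi^m(s)=su\varphi(u)\varphi^2(u)\cdots$ is the infinite sequence that has every word $\varphi^m(s)$ as a prefix. A sequence $x\in A^{\mathbb N}$ is almost periodic (uniformly recurrent) if for every nonempty word $u$ occurring in $x$ there is a number $l$ such that every word of length $l$ occurring in $x$ contains an occurrence of $u$. There is an algorithm that, given $n$, a non-erasing morphism $\varphi\colon A^*\to A^*$ (as the list of the words $\varphi(b)$, $b\in A$) and a letter $s\in A$ on which $\varphi$ is prolongable, decides whether $\varphi^\infty(s)$ is almost periodic, in time polynomial in $n=|A|$ and $k=\max_{b\in A}|\varphi(b)|$. That is, there are one program for a random access machine (with addition and truncated subtraction of natural numbers, array access, conditionals and while-loops, each executed instruction or test counted as one step) and constants $c,d\in\mathbb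 N$ such that for every such input the program halts after at most $c\,(n+k)^d$ steps, with output $1$ if $\varphi^\infty(s)$ is almost periodic and output $0$ otherwise. -/

import Mathlib

namespace PureMorphic

/-! ### Sequences, almost periodicity -/

section Words

variable {α : Type*}

/-- The word `x(i) x(i+1) … x(i+l-1)` of length `l` of the sequence `x`. -/
def subword (x : ℕ → α) (i l : ℕ) : List α :=
  (List.range l).map fun j => x (i + j)

/-- A factor of `x` is a nonempty word that occurs in `x`. -/
def IsFactor (x : ℕ → α) (u : List α) : Prop :=
  u ≠ [] ∧ ∃ i, subword x i u.length = u

/-- `x` is almost periodic (uniformly recurrent): for every factor `u` there is a length `l`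
such that every word of length `l` occurring in `x` contains an occurrence of `u`. -/
def AlmostPeriodic (x : ℕ → α) : Prop :=
  ∀ u : List α, IsFactor x u → ∃ l : ℕ, ∀ i : ℕ, u <:+: subword x i l

/-! ### Morphisms

A morphism of the free monoid on `α` is given by its values on the letters. -/

/-- The value on a word of the morphism with values `φ` on the letters. -/
def applyWord (φ : α → List α) (w : List α) : List α :=
  w.flatMap φ

/-- The word `φ^m(w)`. -/
def iterWord (φ : α → List α) (m : ℕ) (w : List α) : List α :=
  (applyWord φ)^[m] w

/-- Every letter has a nonempty image. -/
def NonErasing (φ : α → List α) : Prop :=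
  ∀ b, φ b ≠ []

/-- `φ(s) = s u` for some word `u` with `φ^m(u)` nonempty for all `m`. -/
def Prolongable (φ : α → List α) (s : α) : Prop :=
  ∃ u : List α, φ s = s :: u ∧ ∀ m, iterWord φ m u ≠ []

/-- The infinite word `φ^∞(s) = lim φ^m(s)`, for `φ` prolongable on `s`. Its letter number `i`
is read off `φ^i(s)`, which is long enough; `limitWord_prefix` and `lt_length_iterWord` show that
this is the sequence that has all the words `φ^m(s)` as prefixes. -/
def limitWord (φ : α → List α) (s : α) : ℕ → α :=
  fun i => (iterWord φ i [s]).getD i s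

theorem iterWord_succ (φ : α → List α) (m : ℕ) (w : List α) :
    iterWord φ (m + 1) w = iterWord φ m (applyWord φ w) := by
  simp [iterWord, Function.iterate_succ_apply]

theorem iterWord_append (φ : α → List α) (m : ℕ) (v w : List α) :
    iterWord φ m (v ++ w) = iterWord φ m v ++ iterWord φ m w := by
  induction m generalizing v w with
  | zero => rfl
  | succ m ih =>
    rw [iterWord_succ, iterWord_succ, iterWord_succ, ← ih]
    simp [applyWord]

theorem iterWord_succ_singleton {φ : α → List α} {s : α} {u : List α} (h : φ s = s :: u)
    (m : ℕ) : iterWord φ (m + 1) [s] = iterWord φ m [s] ++ iterWord φ m u := by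
  rw [iterWord_succ, ← iterWord_append]
  simp [applyWord, h]

theorem lt_length_iterWord {φ : α → List α} {s : α} (h : Prolongable φ s) (m : ℕ) :
    m < (iterWord φ m [s]).length := by
  obtain ⟨u, hu, hne⟩ := h
  induction m with
  | zero => simp [iterWord]
  | succ m ih =>
    have := List.length_pos_iff.mpr (hne m)
    rw [iterWord_succ_singleton hu, List.length_append]
    omega

theorem iterWord_prefix {φ : α → List α} {s : α} (h : Prolongable φ s) {m k : ℕ} (hmk : m ≤ k) :
    iterWord φ m [s] <+: iterWord φ k [s] := by
  obtain ⟨u, hu, -⟩ := h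
  induction k, hmk using Nat.le_induction with
  | base => exact List.prefix_rfl
  | succ k _ ih =>
    rw [iterWord_succ_singleton hu]
    exact ih.trans (List.prefix_append _ _)

theorem limitWord_prefix {φ : α → List α} {s : α} (h : Prolongable φ s) (m : ℕ) :
    subword (limitWord φ s) 0 (iterWord φ m [s]).length = iterWord φ m [s] := by
  apply List.ext_getElem
  · simp [subword]
  · intro i h1 h2
    have hi := lt_length_iterWord h i
    simp only [subword, limitWord, List.getElem_map, List.getElem_range, zero_add]
    rw [List.getD_eq_getElem _ _ hi]
    rcases le_total m i with hmi | him
    · exact ((iterWord_prefix h hmi).getElem h2).symm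
    · exact (iterWord_prefix h him).getElem hi

end Words

/-! ### Random access machines

Programs work on registers and arrays of natural numbers; a program is a finite object, so it
uses finitely many registers and arrays. Every executed instruction and every test costs one
step. The arithmetic is addition and (truncated) subtraction only, so numbers have at most
linearly many bits in the number of steps, and polynomial time is the usual notion. -/

/-- Contents of the registers and of the arrays (array number, index). -/
structure State where
  reg : ℕ → ℕ
  mem : ℕ → ℕ → ℕ

def State.setReg (σ : State) (x v : ℕ) : State :=
  { σ with reg := Function.update σ.reg x v }

def State.setMem (σ : State) (a i v : ℕ) : State :=
  { σ with mem := Function.update σ.mem a (Function.update (σ.mem a) i v) }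

/-- Programs. The numerals `x`, `y`, `z` name registers and `a` names an array. -/
inductive Cmd where
  /-- do nothing -/
  | skip
  /-- `x := c` -/
  | const (x c : ℕ)
  /-- `x := y` -/
  | copy (x y : ℕ)
  /-- `x := y + z` -/
  | add (x y z : ℕ)
  /-- `x := max (y - z) 0` -/
  | sub (x y z : ℕ)
  /-- `x := a[y]` -/
  | load (x a y : ℕ)
  /-- `a[x] := y` -/
  | store (a x y : ℕ)
  /-- first `p`, then `q` -/
  | seq (p q : Cmd)
  /-- if `x ≠ 0` then `p` else `q` -/
  | cond (x : ℕ) (p q : Cmd)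
  /-- while `x ≠ 0` do `p` -/
  | loop (x : ℕ) (p : Cmd)

/-- `Exec p σ τ t`: started in the state `σ`, the program `p` halts in the state `τ` after
exactly `t` steps. -/
inductive Exec : Cmd → State → State → ℕ → Prop where
  | skip (σ : State) : Exec .skip σ σ 1
  | const (σ : State) (x c : ℕ) : Exec (.const x c) σ (σ.setReg x c) 1
  | copy (σ : State) (x y : ℕ) : Exec (.copy x y) σ (σ.setReg x (σ.reg y)) 1
  | add (σ : State) (x y z : ℕ) :
      Exec (.add x y z) σ (σ.setReg x (σ.reg y + σ.reg z)) 1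
  | sub (σ : State) (x y z : ℕ) :
      Exec (.sub x y z) σ (σ.setReg x (σ.reg y - σ.reg z)) 1
  | load (σ : State) (x a y : ℕ) :
      Exec (.load x a y) σ (σ.setReg x (σ.mem a (σ.reg y))) 1
  | store (σ : State) (a x y : ℕ) :
      Exec (.store a x y) σ (σ.setMem a (σ.reg x) (σ.reg y)) 1
  | seq {p q : Cmd} {σ τ υ : State} {t t' : ℕ} :
      Exec p σ τ t → Exec q τ υ t' → Exec (.seq p q) σ υ (t + t')
  | condTrue {x : ℕ} {p : Cmd} (q : Cmd) {σ τ : State} {t : ℕ} :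
      σ.reg x ≠ 0 → Exec p σ τ t → Exec (.cond x p q) σ τ (t + 1)
  | condFalse {x : ℕ} (p : Cmd) {q : Cmd} {σ τ : State} {t : ℕ} :
      σ.reg x = 0 → Exec q σ τ t → Exec (.cond x p q) σ τ (t + 1)
  | loopStop {x : ℕ} (p : Cmd) {σ : State} :
      σ.reg x = 0 → Exec (.loop x p) σ σ 1
  | loopStep {x : ℕ} {p : Cmd} {σ τ υ : State} {t t' : ℕ} :
      σ.reg x ≠ 0 → Exec p σ τ t → Exec (.loop x p) τ υ t' →
        Exec (.loop x p) σ υ (t + t' + 1)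

/-- Programs are deterministic: the final state and the number of steps are unique. -/
theorem Exec.unique {p : Cmd} {σ τ τ' : State} {t t' : ℕ} (h : Exec p σ τ t)
    (h' : Exec p σ τ' t') : τ = τ' ∧ t = t' := by
  induction h generalizing τ' t' with
  | seq _ _ ih1 ih2 =>
    cases h' with
    | seq h1 h2 =>
      obtain ⟨rfl, rfl⟩ := ih1 h1
      obtain ⟨rfl, rfl⟩ := ih2 h2
      exact ⟨rfl, rfl⟩
  | condTrue _ hx _ ih =>
    cases h' with
    | condTrue _ _ h1 =>
      obtain ⟨rfl, rfl⟩ := ih h1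
      exact ⟨rfl, rfl⟩
    | condFalse _ hx' _ => exact absurd hx' hx
  | condFalse _ hx _ ih =>
    cases h' with
    | condFalse _ _ h1 =>
      obtain ⟨rfl, rfl⟩ := ih h1
      exact ⟨rfl, rfl⟩
    | condTrue _ hx' _ => exact absurd hx hx'
  | loopStop _ hx =>
    cases h' with
    | loopStop => exact ⟨rfl, rfl⟩
    | loopStep hx' _ _ => exact absurd hx hx'
  | loopStep hx _ _ ih1 ih2 =>
    cases h' with
    | loopStop _ hx' => exact absurd hx' hx
    | loopStep _ h1 h2 =>
      obtain ⟨rfl, rfl⟩ := ih1 h1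
      obtain ⟨rfl, rfl⟩ := ih2 h2
      exact ⟨rfl, rfl⟩
  | _ => cases h'; exact ⟨rfl, rfl⟩

/-- Initial state: the input list is in array `0`, everything else is `0`. -/
def initState (input : List ℕ) : State where
  reg := fun _ => 0
  mem := fun a i => if a = 0 then input.getD i 0 else 0

/-! ### The decision problem -/

/-- The input that presents a morphism `φ` over the alphabet `{0, …, n-1}` and a letter `s`:
the numbers `n` and `s`, then for `b = 0, …, n-1` the length of `φ(b)` and its letters. -/
def encode {n : ℕ} (φ : Fin n → List (Fin n)) (s : Fin n) : List ℕ :=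
  n :: s.val :: (List.finRange n).flatMap fun b => (φ b).length :: (φ b).map Fin.val

/-- The maximal length of the image of a letter. -/
def maxImageLength {n : ℕ} (φ : Fin n → List (Fin n)) : ℕ :=
  Finset.univ.sup fun b => (φ b).length

end PureMorphic

namespace PureMorphic

/-! ### Iterates of morphisms -/

section Iterates

variable {α : Type*}

/-! Put x = φ^∞(s) and call a letter marked if some iterated image of it contains s. Then x is
almost periodic iff the unmarked words in x have bounded length (`almostPeriodic_iff_runsLE`): s is
marked and has to recur with bounded gaps; conversely a factor lies in some φ^M(s), hence in
φ^(M+N)(c) for every marked c with a common N, and marked letters have bounded gaps.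

An unmarked word in an iterated image is either inside one block or composed of unmarked suffixes
and prefixes of blocks, so it suffices to bound those for the letters reachable from s
(`runsLE_iterWord`). Unmarked letters have unmarked images, so cutting φ^m(b) before its last marked
letter gives an iterate of the morphism `tailMorphism` (`Respects.keep_iterWord`); prefixes become
suffixes under reversal. Whether lengths stay bounded is visible in the step from n to n+1: a letter
growing there grows infinitely often (`NonErasing.unbounded_of_growsAt`), and if no letter of a
closed set grows there, none grows later. This gives `almostPeriodic_iff_not_growsAt`.

Iterated words may be exponentially long, but only lengths and occurrence counts are needed, and
these come from pulling letter weights back n or n+1 times (`pull_iterate`). Four such phases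
suffice: marks, growth of suffixes, growth of prefixes, and the total growth over the letters of
φ^(n+1)(s). -/

theorem iterWord_eq_flatMap (φ : α → List α) (m : ℕ) (w : List α) :
    iterWord φ m w = w.flatMap fun c => iterWord φ m [c] := by
  induction w with
  | nil =>
    induction m with
    | zero => rfl
    | succ m ih => rw [iterWord_succ]; simpa [applyWord] using ih
  | cons c w ih =>
    rw [List.flatMap_cons, ← ih, ← iterWord_append, List.singleton_append]

theorem iterWord_add (φ : α → List α) (m k : ℕ) (w : List α) :
    iterWord φ (m + k) w = iterWord φ m (iterWord φ k w) :=
  Function.iterate_add_apply _ _ _ _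

theorem iterWord_succ' (φ : α → List α) (m : ℕ) (w : List α) :
    iterWord φ (m + 1) w = applyWord φ (iterWord φ m w) :=
  Function.iterate_succ_apply' _ _ _

theorem iterWord_succ_letter (φ : α → List α) (m : ℕ) (b : α) :
    iterWord φ (m + 1) [b] = iterWord φ m (φ b) := by
  rw [iterWord_succ]; simp [applyWord]

theorem mem_iterWord {φ : α → List α} {m : ℕ} {w : List α} {a : α} :
    a ∈ iterWord φ m w ↔ ∃ c ∈ w, a ∈ iterWord φ m [c] := by
  rw [iterWord_eq_flatMap, List.mem_flatMap]

theorem mem_iterWord_succ {φ : α → List α} {m : ℕ} {a b : α} :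
    a ∈ iterWord φ (m + 1) [b] ↔ ∃ c ∈ φ b, a ∈ iterWord φ m [c] := by
  rw [iterWord_succ_letter, mem_iterWord]

theorem mem_iterWord_succ' {φ : α → List α} {m : ℕ} {w : List α} {a : α} :
    a ∈ iterWord φ (m + 1) w ↔ ∃ c ∈ iterWord φ m w, a ∈ φ c := by
  rw [iterWord_succ', applyWord, List.mem_flatMap]

theorem iterWord_infix {φ : α → List α} {v w : List α} (h : v <:+: w) (m : ℕ) :
    iterWord φ m v <:+: iterWord φ m w := by
  obtain ⟨a, b, rfl⟩ := h
  simp [iterWord_append]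

theorem iterWord_letter_infix {φ : α → List α} {b : α} {w : List α} (h : b ∈ w) (m : ℕ) :
    iterWord φ m [b] <:+: iterWord φ m w := by
  obtain ⟨u, v, rfl⟩ := List.append_of_mem h
  exact iterWord_infix ⟨u, v, by simp⟩ m

/-- Reversing all images turns statements about suffixes into statements about prefixes. -/
theorem iterWord_reverse (φ : α → List α) (m : ℕ) (w : List α) :
    iterWord (fun b => (φ b).reverse) m w.reverse = (iterWord φ m w).reverse := by
  induction m generalizing w with
  | zero => rfl
  | succ m ih =>
    rw [iterWord_succ, iterWord_succ, ← ih]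
    congr 1
    simp [applyWord, List.reverse_flatMap, Function.comp_def]

theorem NonErasing.length_le {φ : α → List α} (h : NonErasing φ) (w : List α) :
    w.length ≤ (applyWord φ w).length := by
  induction w with
  | nil => simp
  | cons c w ih =>
    have := List.length_pos_iff.mpr (h c)
    simp only [applyWord, List.flatMap_cons, List.length_append, List.length_cons] at ih ⊢
    omega

theorem NonErasing.length_mono {φ : α → List α} (h : NonErasing φ) (w : List α) :
    Monotone fun m => (iterWord φ m w).length :=
  monotone_nat_of_le_succ fun m => by rw [iterWord_succ']; exact h.length_le _

/-- The letter weights `f` pulled back along the morphism `φ`. -/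
def pull (φ : α → List α) (f : α → ℕ) (b : α) : ℕ := ((φ b).map f).sum

theorem sum_pull (φ : α → List α) (f : α → ℕ) (w : List α) :
    (w.map (pull φ f)).sum = ((applyWord φ w).map f).sum := by
  induction w with
  | nil => rfl
  | cons c w ih => simp [applyWord, pull] at ih ⊢; omega

/-- The weight 1 yields the length of φ^m(b), the indicator of s the number of occurrences of s,
without writing the word down. -/
theorem pull_iterate (φ : α → List α) (f : α → ℕ) (m : ℕ) (b : α) :
    (pull φ)^[m] f b = ((iterWord φ m [b]).map f).sum := by
  have key : ∀ w : List α, (w.map ((pull φ)^[m] f)).sum = ((iterWord φ m w).map f).sum := by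
    induction m with
    | zero => intro w; rfl
    | succ m ih =>
      intro w
      rw [Function.iterate_succ_apply', sum_pull, ih, iterWord_succ]
  simpa using key [b]

end Iterates

/-! ### Stabilization after as many steps as there are letters -/

section Stabilization

variable {α : Type*}

/-- The cardinality can rise at most `Fintype.card α` times, and by the recursion one repetition
makes the sequence constant. -/
theorem stable_of_monotone [Fintype α] {S : ℕ → Set α} (hS : Monotone S) (Φ : Set α → Set α)
    (h : ∀ m, S (m + 1) = Φ (S m)) {m : ℕ} (hm : Fintype.card α ≤ m) :
    S m = S (Fintype.card α) := by
  classical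
  have hfin : ∀ m, (S m).Finite := fun m => Set.toFinite _
  have hcard := Nat.stabilises_of_monotone (f := fun m => (S m).ncard) (b := Fintype.card α)
    (fun a b hab => Set.ncard_le_ncard (hS hab) (hfin b))
    (fun m => by rw [← Nat.card_eq_fintype_card]; exact Set.ncard_le_card (S m))
    (fun m hm => by
      have : S m = S (m + 1) := Set.eq_of_subset_of_ncard_le (hS (Nat.le_succ m)) hm.ge (hfin _)
      have h2 : S (m + 1) = S (m + 2) :=
        (h m).trans ((congrArg Φ this).trans (h (m + 1)).symm)
      exact congrArg Set.ncard h2) hm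
  exact (Set.eq_of_subset_of_ncard_le (hS hm) hcard.le (hfin _)).symm

theorem mem_iterWord_stable_target [Fintype α] {φ : α → List α} {s b : α} (hs : s ∈ φ s) {m k : ℕ}
    (hk : Fintype.card α ≤ k) (h : s ∈ iterWord φ m [b]) : s ∈ iterWord φ k [b] := by
  have hmono : Monotone fun m => {b | s ∈ iterWord φ m [b]} :=
    monotone_nat_of_le_succ fun m b hb => mem_iterWord_succ'.mpr ⟨s, hb, hs⟩
  have hst := fun m (hm : Fintype.card α ≤ m) => stable_of_monotone hmono
    (fun S => {b | ∃ c ∈ φ b, c ∈ S}) (fun m => Set.ext fun b => mem_iterWord_succ) hm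
  have h1 : b ∈ {b | s ∈ iterWord φ (max m k) [b]} := hmono (le_max_left m k) h
  have h2 := (hst (max m k) (hk.trans (le_max_right _ _))).trans (hst k hk).symm
  exact (Set.ext_iff.mp h2 b).mp h1

theorem mem_iterWord_stable_source [Fintype α] {φ : α → List α} {s b : α} (hs : s ∈ φ s) {m k : ℕ}
    (hk : Fintype.card α ≤ k) (h : b ∈ iterWord φ m [s]) : b ∈ iterWord φ k [s] := by
  have hmono : Monotone fun m => {b | b ∈ iterWord φ m [s]} :=
    monotone_nat_of_le_succ fun m b hb => mem_iterWord_succ.mpr ⟨s, hs, hb⟩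
  have hst := fun m (hm : Fintype.card α ≤ m) => stable_of_monotone hmono
    (fun S => {b | ∃ c ∈ S, b ∈ φ c}) (fun m => Set.ext fun b => mem_iterWord_succ') hm
  have h1 : b ∈ {b | b ∈ iterWord φ (max m k) [s]} := hmono (le_max_left m k) h
  have h2 := (hst (max m k) (hk.trans (le_max_right _ _))).trans (hst k hk).symm
  exact (Set.ext_iff.mp h2 b).mp h1

/-- The length of the iterated image of the letter `b` increases in step `m`. -/
def GrowsAt (φ : α → List α) (m : ℕ) (b : α) : Prop :=
  (iterWord φ m [b]).length < (iterWord φ (m + 1) [b]).length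

/-- Length is additive over letters and no letter's contribution ever decreases, so a word grows iff
one of its letters does. -/
theorem NonErasing.growsAt_succ {φ : α → List α} (h : NonErasing φ) {m : ℕ} {b : α} :
    GrowsAt φ (m + 1) b ↔ ∃ c ∈ φ b, GrowsAt φ m c := by
  have key : ∀ w : List α, (iterWord φ m w).length < (iterWord φ (m + 1) w).length ↔
      ∃ c ∈ w, GrowsAt φ m c := by
    intro w
    induction w with
    | nil => simp [iterWord_eq_flatMap φ _ []]
    | cons c w ih =>
      have h1 := h.length_mono [c] (Nat.le_add_right m 1)
      have h2 := h.length_mono w (Nat.le_add_right m 1)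
      simp only [] at h1 h2
      rw [← List.singleton_append, iterWord_append, iterWord_append, List.length_append,
        List.length_append]
      simp only [List.singleton_append, List.mem_cons, exists_eq_or_imp, GrowsAt] at ih ⊢
      rw [← ih]
      omega
  unfold GrowsAt
  rw [iterWord_succ_letter, iterWord_succ_letter]
  exact key _

/-- The sets of letters growing in step m need not be monotone in m. The sets of letters that never
grow from step m on are, and they satisfy a recursion, so they are stable from `Fintype.card α` on;
a letter outside that set grows infinitely often. -/
theorem NonErasing.unbounded_of_growsAt [Fintype α] {φ : α → List α} (h : NonErasing φ) {b : α}
    (hb : GrowsAt φ (Fintype.card α) b) (K : ℕ) : ∃ m, K ≤ (iterWord φ m [b]).length := by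
  have hmono : Monotone fun m => {b | ∀ j, m ≤ j → ¬ GrowsAt φ j b} :=
    fun a b hab c hc j hj => hc j (hab.trans hj)
  have hst := fun m (hm : Fintype.card α ≤ m) => stable_of_monotone hmono
    (fun S => {b | ∀ c ∈ φ b, c ∈ S}) (fun m => by
      ext b
      constructor
      · exact fun hb c hc j hj hg => hb (j + 1) (by omega) (h.growsAt_succ.mpr ⟨c, hc, hg⟩)
      · intro hb j hj hg
        obtain ⟨j, rfl⟩ := Nat.exists_eq_succ_of_ne_zero (by omega : j ≠ 0)
        obtain ⟨c, hc, hg⟩ := h.growsAt_succ.mp hg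
        exact hb c hc j (by omega) hg) hm
  have hinf : ∀ m, ∃ j, m ≤ j ∧ GrowsAt φ j b := by
    intro m
    by_contra! hcon
    have h1 : b ∈ {b | ∀ j, max m (Fintype.card α) ≤ j → ¬ GrowsAt φ j b} :=
      fun j hj => hcon j ((le_max_left _ _).trans hj)
    exact (Set.ext_iff.mp (hst _ (le_max_right _ _)) b).mp h1 _ le_rfl hb
  induction K with
  | zero => exact ⟨0, Nat.zero_le _⟩
  | succ K ih =>
    obtain ⟨m, hm⟩ := ih
    obtain ⟨j, hmj, hj⟩ := hinf m
    exact ⟨j + 1, (hm.trans (h.length_mono [b] hmj)).trans_lt hj⟩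

/-- Growth in a later step would descend to growth of a letter of the closed set `R` in step `k`. -/
theorem NonErasing.length_le_of_not_growsAt {φ : α → List α} (h : NonErasing φ) {R : α → Prop}
    (hR : ∀ b, R b → ∀ c ∈ φ b, R c) {k : ℕ} (hk : ∀ b, R b → ¬ GrowsAt φ k b) {b : α} (hb : R b)
    (m : ℕ) : (iterWord φ m [b]).length ≤ (iterWord φ k [b]).length := by
  have hg : ∀ j, ∀ b, R b → ¬ GrowsAt φ (k + j) b := by
    intro j
    induction j with
    | zero => exact hk
    | succ j ih =>
      intro b hb hg
      obtain ⟨c, hc, hg⟩ := h.growsAt_succ.mp hg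
      exact ih c (hR b hb c hc) hg
  have hle : ∀ j, (iterWord φ (k + j) [b]).length ≤ (iterWord φ k [b]).length := by
    intro j
    induction j with
    | zero => exact le_rfl
    | succ j ih => exact (not_lt.mp (hg j b hb)).trans ih
  exact (h.length_mono [b] (Nat.le_add_left m k)).trans (hle m)

end Stabilization
/-! ### Runs without marked letters -/

section Runs

variable {α : Type*}

/-- The word `v` contains no marked letter. -/
def Unmarked (G : α → Prop) (v : List α) : Prop := ∀ c ∈ v, ¬ G c

theorem Unmarked.of_infix {G : α → Prop} {v w : List α} (h : Unmarked G w) (hv : v <:+: w) :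
    Unmarked G v := fun c hc => h c (hv.subset hc)

/-- The suffix of `w` that starts at its last marked letter, and `w` itself if there is none. -/
def keep (G : α → Prop) [DecidablePred G] (w : List α) : List α :=
  w.foldl (fun a c => if G c then [c] else a ++ [c]) []

/-- The sum of the weights `f` over the letters of `keep G w`, computed in one pass. -/
def scan (G : α → Prop) [DecidablePred G] (f : α → ℕ) (w : List α) : ℕ :=
  w.foldl (fun a c => if G c then f c else a + f c) 0

variable {G : α → Prop} [DecidablePred G]

theorem keep_concat (w : List α) (c : α) :
    keep G (w ++ [c]) = if G c then [c] else keep G w ++ [c] := by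
  simp [keep, List.foldl_append]

theorem scan_concat (f : α → ℕ) (w : List α) (c : α) :
    scan G f (w ++ [c]) = if G c then f c else scan G f w + f c := by
  simp [scan, List.foldl_append]

theorem scan_eq_sum (f : α → ℕ) (w : List α) : scan G f w = ((keep G w).map f).sum := by
  induction w using List.reverseRecOn with
  | nil => rfl
  | append_singleton w c ih =>
    rw [scan_concat, keep_concat, ih]
    split_ifs <;> simp

theorem keep_append_of_unmarked (u : List α) {v : List α} (hv : Unmarked G v) :
    keep G (u ++ v) = keep G u ++ v := by
  induction v using List.reverseRecOn with
  | nil => simp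
  | append_singleton v c ih =>
    rw [← List.append_assoc, keep_concat, if_neg (hv c (by simp)),
      ih (hv.of_infix (List.prefix_append v [c]).isInfix), List.append_assoc]

theorem keep_of_unmarked {v : List α} (hv : Unmarked G v) : keep G v = v := by
  simpa [keep] using keep_append_of_unmarked [] hv

theorem keep_append_of_marked (u : List α) {v : List α} {c : α} (hc : c ∈ v) (hG : G c) :
    keep G (u ++ v) = keep G v := by
  induction v using List.reverseRecOn with
  | nil => simp at hc
  | append_singleton v d ih =>
    rw [← List.append_assoc, keep_concat, keep_concat]
    split_ifs with hd
    · rfl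
    · rcases List.mem_append.mp hc with h | h
      · rw [ih h]
      · rw [List.mem_singleton.mp h] at hG
        exact absurd hG hd

theorem keep_suffix (w : List α) : keep G w <:+ w := by
  induction w using List.reverseRecOn with
  | nil => simp [keep]
  | append_singleton w c ih =>
    rw [keep_concat]
    split_ifs
    · exact List.suffix_append _ _
    · obtain ⟨t, ht⟩ := ih
      exact ⟨t, by rw [← List.append_assoc, ht]⟩

theorem keep_ne_nil {w : List α} (hw : w ≠ []) : keep G w ≠ [] := by
  induction w using List.reverseRecOn with
  | nil => exact absurd rfl hw
  | append_singleton w c _ =>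
    rw [keep_concat]
    split_ifs <;> simp

theorem length_le_length_keep {t w : List α} (ht : t <:+ w) (hG : Unmarked G t) :
    t.length ≤ (keep G w).length := by
  obtain ⟨u, rfl⟩ := ht
  rw [keep_append_of_unmarked u hG]
  simp

/-- The only letter of `keep G w` that can be marked is its first, whence the `+ 1`. -/
theorem exists_unmarked_suffix (w : List α) :
    ∃ t, t <:+ w ∧ Unmarked G t ∧ (keep G w).length ≤ t.length + 1 := by
  induction w using List.reverseRecOn with
  | nil => exact ⟨[], by simp, by simp [Unmarked], by simp [keep]⟩
  | append_singleton w c ih =>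
    obtain ⟨t, ⟨u, hu⟩, hG, hl⟩ := ih
    rw [keep_concat]
    split_ifs with hc
    · exact ⟨[], by simp, by simp [Unmarked], by simp⟩
    · refine ⟨t ++ [c], ⟨u, by rw [← hu, List.append_assoc]⟩, ?_, by simpa using hl⟩
      intro d hd
      rcases List.mem_append.mp hd with h | h
      · exact hG d h
      · rwa [List.mem_singleton.mp h]

/-- The morphism `φ` maps unmarked letters to unmarked words, and the images of marked letters
contain marked letters. -/
def Respects (φ : α → List α) (G : α → Prop) : Prop :=
  ∀ b, G b ↔ ∃ c ∈ φ b, G c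

theorem Respects.reverse {G : α → Prop} {φ : α → List α} (h : Respects φ G) :
    Respects (fun b => (φ b).reverse) G := by
  intro b; simpa using h b

/-- The last marked letter of φ(w) lies in the image of the last marked letter of w, since
everything after it has an unmarked image. -/
theorem Respects.keep_applyWord {φ : α → List α} (h : Respects φ G) (w : List α) :
    keep G (applyWord φ w) = applyWord (fun b => keep G (φ b)) (keep G w) := by
  induction w using List.reverseRecOn with
  | nil => rfl
  | append_singleton w c ih =>
    have happ : ∀ (ψ : α → List α) (u : List α), applyWord ψ (u ++ [c]) = applyWord ψ u ++ ψ c := by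
      intro ψ u; simp [applyWord]
    rw [happ, keep_concat]
    split_ifs with hc
    · obtain ⟨d, hd, hG⟩ := (h c).mp hc
      rw [keep_append_of_marked _ hd hG]
      simp [applyWord]
    · have hu : Unmarked G (φ c) := fun d hd hG => hc ((h c).mpr ⟨d, hd, hG⟩)
      rw [keep_append_of_unmarked _ hu, happ, ih, keep_of_unmarked hu]

theorem Respects.keep_iterWord {φ : α → List α} (h : Respects φ G) (m : ℕ) (b : α) :
    keep G (iterWord φ m [b]) = iterWord (fun b => keep G (φ b)) m [b] := by
  induction m with
  | zero => simp [iterWord, keep]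
  | succ m ih => rw [iterWord_succ', iterWord_succ', h.keep_applyWord, ih]

/-- Every unmarked word occurring in `w` has length at most `B`. -/
def RunsLE (G : α → Prop) (w : List α) (B : ℕ) : Prop :=
  ∀ v, v <:+: w → Unmarked G v → v.length ≤ B

/-- An unmarked prefix ends in the first block or covers it; a covered block is a prefix of itself,
so it also has length at most `K`. -/
theorem length_prefix_flatMap_le {G : α → Prop} {h : α → List α} {K : ℕ} {w v : List α}
    (hK : ∀ c ∈ w, ∀ t, t <+: h c → Unmarked G t → t.length ≤ K)
    (hv : v <+: w.flatMap h) (hG : Unmarked G v) : v.length ≤ w.length * K := by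
  induction w generalizing v with
  | nil => simp at hv; simp [hv]
  | cons c w ih =>
    have hc := hK c (by simp)
    have hw := fun v => @ih v fun c hc => hK c (by simp [hc])
    rw [List.flatMap_cons] at hv
    rw [List.length_cons, Nat.succ_mul]
    rcases List.prefix_or_prefix_of_prefix hv (List.prefix_append _ _) with h1 | ⟨t, rfl⟩
    · have := hc v h1 hG
      omega
    · rw [List.prefix_append_right_inj] at hv
      have h1 := hc (h c) List.prefix_rfl (hG.of_infix (List.prefix_append _ t).isInfix)
      have h2 := hw t hv (hG.of_infix (List.suffix_append _ t).isInfix)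
      rw [List.length_append]
      omega

theorem runsLE_flatMap {G : α → Prop} {h : α → List α} {K B : ℕ} {w : List α}
    (hpre : ∀ c ∈ w, ∀ t, t <+: h c → Unmarked G t → t.length ≤ K)
    (hsuf : ∀ c ∈ w, ∀ t, t <:+ h c → Unmarked G t → t.length ≤ K)
    (hB : ∀ c ∈ w, RunsLE G (h c) B) (hw : w.length * K ≤ B) : RunsLE G (w.flatMap h) B := by
  induction w with
  | nil => intro v hv _; simp at hv; simp [hv]
  | cons c w ih =>
    rw [List.length_cons, Nat.succ_mul] at hw
    intro v hv hG
    rw [List.flatMap_cons, List.infix_append_iff] at hv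
    rcases hv with hv | hv | ⟨t₁, t₂, rfl, h₁, h₂⟩
    · exact hB c (by simp) v hv hG
    · exact ih (fun c hc => hpre c (by simp [hc])) (fun c hc => hsuf c (by simp [hc]))
        (fun c hc => hB c (by simp [hc])) (by omega) v hv hG
    · have h1 := hsuf c (by simp) t₁ h₁ (hG.of_infix (List.prefix_append _ _).isInfix)
      have h2 := length_prefix_flatMap_le (fun c hc => hpre c (by simp [hc])) h₂
        (hG.of_infix (List.suffix_append _ _).isInfix)
      rw [List.length_append]
      omega

/-- A run in φ^(m+1)(b) either lies in one block φ^m(c), where induction applies, or crosses a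
boundary and takes at most `K` letters from each of at most `k` blocks. The bound therefore does not
depend on `m`; the `+ 1` serves the single letter at m = 0. -/
theorem runsLE_iterWord {G : α → Prop} {φ : α → List α} {R : α → Prop} (hR : ∀ b, R b → ∀ c ∈ φ b, R c)
    {k K : ℕ} (hk : ∀ b, (φ b).length ≤ k)
    (hpre : ∀ b, R b → ∀ m t, t <+: iterWord φ m [b] → Unmarked G t → t.length ≤ K)
    (hsuf : ∀ b, R b → ∀ m t, t <:+ iterWord φ m [b] → Unmarked G t → t.length ≤ K)
    (m : ℕ) (b : α) (hb : R b) : RunsLE G (iterWord φ m [b]) (k * K + 1) := by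
  induction m generalizing b with
  | zero =>
    intro v hv _
    have := hv.length_le
    simp [iterWord] at this
    omega
  | succ m ih =>
    rw [iterWord_succ_letter, iterWord_eq_flatMap]
    exact runsLE_flatMap (fun c hc => hpre c (hR b hb c hc) m)
      (fun c hc => hsuf c (hR b hb c hc) m) (fun c hc => ih c (hR b hb c hc))
      ((Nat.mul_le_mul_right K (hk b)).trans (Nat.le_succ _))

end Runs
/-! ### The criterion for almost periodicity -/

section Criterion

variable {α : Type*}

@[simp]
theorem length_subword (x : ℕ → α) (i l : ℕ) : (subword x i l).length = l := by
  simp [subword]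

theorem subword_add (x : ℕ → α) (i l k : ℕ) :
    subword x i (l + k) = subword x i l ++ subword x (i + l) k := by
  simp [subword, List.range_add, Function.comp_def, add_assoc]

theorem subword_infix {x : ℕ → α} {i j l k : ℕ} (hij : i ≤ j) (hjk : j + k ≤ i + l) :
    subword x j k <:+: subword x i l := by
  obtain ⟨a, rfl⟩ := Nat.exists_eq_add_of_le hij
  obtain ⟨b, rfl⟩ := Nat.exists_eq_add_of_le (show a + k ≤ l by omega)
  rw [subword_add, subword_add]
  exact List.infix_append _ _ _

theorem exists_subword_of_infix {x : ℕ → α} {i l : ℕ} {v : List α} (h : v <:+: subword x i l) :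
    ∃ j, subword x j v.length = v := by
  obtain ⟨a, b, hab⟩ := h
  have hl := congrArg List.length hab
  simp only [List.length_append, length_subword] at hl
  refine ⟨i + a.length, ?_⟩
  rw [← hl, subword_add, subword_add] at hab
  exact (List.append_inj (List.append_inj hab (by simp)).1 (by simp)).2.symm

variable {φ : α → List α} {s : α}

theorem Prolongable.mem (h : Prolongable φ s) : s ∈ φ s := by
  obtain ⟨u, hu, -⟩ := h
  simp [hu]

theorem subword_limitWord_infix (h : Prolongable φ s) (i l m : ℕ) (hm : i + l ≤ m) :
    subword (limitWord φ s) i l <:+: iterWord φ m [s] := by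
  rw [← limitWord_prefix h m]
  have := lt_length_iterWord h m
  exact subword_infix (Nat.zero_le _) (by omega)

/-- Since x is a fixed point of φ, images of prefixes of x are prefixes of x. -/
theorem iterWord_subword_zero (h : Prolongable φ s) (m p : ℕ) :
    iterWord φ m (subword (limitWord φ s) 0 p) =
      subword (limitWord φ s) 0 (iterWord φ m (subword (limitWord φ s) 0 p)).length := by
  have hp := lt_length_iterWord h p
  have key : iterWord φ m (subword (limitWord φ s) 0 p) <+:
      subword (limitWord φ s) 0 (iterWord φ (m + p) [s]).length := by
    rw [limitWord_prefix h, iterWord_add, ← limitWord_prefix h p]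
    obtain ⟨d, hd⟩ := Nat.exists_eq_add_of_lt hp
    rw [hd, add_assoc, subword_add, iterWord_append]
    exact List.prefix_append _ _
  have hle := key.length_le
  rw [length_subword] at hle
  obtain ⟨d, hd⟩ := Nat.exists_eq_add_of_le hle
  rw [hd, subword_add] at key
  exact (List.prefix_of_prefix_length_le key (List.prefix_append _ _) (by simp)).eq_of_length
    (by simp)

/-- Cut x into the blocks φ^m(x(p)), each of length at most `H`. The first block boundary from `i`
on is at most `H` away, and the next `L` blocks take at most `L * H` more letters. -/
theorem exists_iterWord_subword_infix (h : Prolongable φ s) (hφ : NonErasing φ) {m H : ℕ}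
    (hH : ∀ b, (iterWord φ m [b]).length ≤ H) (L i : ℕ) :
    ∃ p, iterWord φ m (subword (limitWord φ s) p L) <:+:
      subword (limitWord φ s) i ((L + 1) * H) := by
  set x := limitWord φ s with hx
  have hHw : ∀ w : List α, (iterWord φ m w).length ≤ w.length * H := by
    intro w
    induction w with
    | nil => simp [iterWord_eq_flatMap φ m []]
    | cons c w ih =>
      rw [← List.singleton_append, iterWord_append, List.length_append, List.length_append,
        add_mul]
      exact Nat.add_le_add (by simpa using hH c) ih
  have hge : ∀ w : List α, w.length ≤ (iterWord φ m w).length := fun w =>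
    hφ.length_mono w (Nat.zero_le m)
  have hex : ∃ p, i ≤ (iterWord φ m (subword x 0 p)).length :=
    ⟨i, by simpa using hge (subword x 0 i)⟩
  classical
  have hp := Nat.find_spec hex
  have hmin := fun q => Nat.find_min hex (m := q)
  set p := Nat.find hex
  have hpH : (iterWord φ m (subword x 0 p)).length ≤ i + H := by
    rcases Nat.eq_zero_or_pos p with h0 | h0
    · rw [h0]; simp [subword, iterWord_eq_flatMap φ m []]
    · have h1 := hmin (p - 1) (by omega)
      have h2 := hHw (subword x (0 + (p - 1)) 1)
      rw [length_subword, one_mul] at h2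
      rw [show p = p - 1 + 1 by omega, subword_add, iterWord_append, List.length_append]
      omega
  refine ⟨p, ?_⟩
  have h1 := iterWord_subword_zero h m (p + L)
  have h2 := hHw (subword x (0 + p) L)
  rw [length_subword] at h2
  rw [← hx, subword_add, iterWord_append, List.length_append, subword_add,
    iterWord_subword_zero h m p, length_subword] at h1
  have h3 := (List.append_inj h1 (by simp)).2
  rw [zero_add] at h3 h2
  rw [h3, ← hx]
  have : (L + 1) * H = L * H + H := by ring
  refine subword_infix (by omega) (by omega)

/-- The morphism that maps a letter `b` to the suffix of `φ(b)` from its last marked letter on. -/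
def tailMorphism (φ : α → List α) (G : α → Prop) [DecidablePred G] (b : α) : List α :=
  keep G (φ b)

theorem NonErasing.tailMorphism {G : α → Prop} [DecidablePred G] (hφ : NonErasing φ) : NonErasing (tailMorphism φ G) :=
  fun b => keep_ne_nil (hφ b)

variable [Fintype α]

/-- The letter `s` occurs in an iterated image of `b`. -/
def Returns (φ : α → List α) (s b : α) : Prop := s ∈ iterWord φ (Fintype.card α + 1) [b]

/-- Membership of s is stable from exponent n on, so n+1 serves as well; it is used because the
program's common loop makes n+1 pullbacks. -/
theorem respects_returns (hs : s ∈ φ s) : Respects φ (Returns φ s) := by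
  intro b
  constructor
  · intro hb
    obtain ⟨c, hc, h⟩ := mem_iterWord_succ.mp hb
    exact ⟨c, hc, mem_iterWord_stable_target hs (Nat.le_succ _) h⟩
  · rintro ⟨c, hc, h⟩
    exact mem_iterWord_stable_target hs (Nat.le_succ _) (mem_iterWord_succ.mpr ⟨c, hc, h⟩)

theorem returns_self (hs : s ∈ φ s) : Returns φ s s :=
  mem_iterWord_stable_target (m := 0) hs (Nat.le_succ _) (by simp [iterWord])

theorem almostPeriodic_iff_runsLE (h : Prolongable φ s) (hφ : NonErasing φ) :
    AlmostPeriodic (limitWord φ s) ↔ ∃ L, ∀ i l, RunsLE (Returns φ s)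
      (subword (limitWord φ s) i l) L := by
  constructor
  · intro hap
    have hs0 : limitWord φ s 0 = s := by simp [limitWord, iterWord]
    obtain ⟨L, hL⟩ := hap [s] ⟨by simp, 0, by simp [subword, hs0]⟩
    refine ⟨L, fun i l v hv hG => ?_⟩
    by_contra! hlt
    obtain ⟨j, hj⟩ := exists_subword_of_infix hv
    have h1 : subword (limitWord φ s) j L <:+: v := by
      conv_rhs => rw [← hj]
      exact subword_infix le_rfl (by omega)
    exact hG s (((hL j).trans h1).subset (by simp)) (returns_self h.mem)
  · rintro ⟨L, hL⟩ u ⟨-, i, hi⟩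
    -- Exponent `N` leads from any marked letter to s, and `M` leads from s to a word containing
    -- `u`.
    set N := Fintype.card α + 1
    set M := i + u.length
    have hu : u <:+: iterWord φ M [s] := by
      conv_lhs => rw [← hi]
      exact subword_limitWord_infix h _ _ _ le_rfl
    set H := Finset.univ.sup fun b => (iterWord φ (M + N) [b]).length
    refine ⟨(L + 1 + 1) * H, fun j => ?_⟩
    obtain ⟨p, hp⟩ := exists_iterWord_subword_infix h hφ (m := M + N) (H := H)
      (fun b => Finset.le_sup (f := fun b => (iterWord φ (M + N) [b]).length)
        (Finset.mem_univ b)) (L + 1) j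
    obtain ⟨c, hc, hG⟩ : ∃ c ∈ subword (limitWord φ s) p (L + 1), Returns φ s c := by
      by_contra! hcon
      have := hL p (L + 1) _ List.infix_rfl hcon
      simp at this
    refine (hu.trans ?_).trans ((iterWord_letter_infix hc (M + N)).trans hp)
    rw [iterWord_add φ M N]
    exact iterWord_letter_infix hG M

variable {G : α → Prop} [DecidablePred G]

theorem not_growsAt_tailMorphism {L : ℕ} (hφ : NonErasing φ) (hr : Respects φ G) {b : α}
    (hL : ∀ m, RunsLE G (iterWord φ m [b]) L) :
    ¬ GrowsAt (tailMorphism φ G) (Fintype.card α) b := by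
  intro hg
  -- Length `L + 2` leaves an unmarked suffix of length at least `L + 1` after the marked head is
  -- dropped.
  obtain ⟨m, hm⟩ := NonErasing.unbounded_of_growsAt hφ.tailMorphism hg (L + 2)
  obtain ⟨t, ht, hG, hle⟩ := exists_unmarked_suffix (G := G) (iterWord φ m [b])
  rw [hr.keep_iterWord] at hle
  have := hL m t ht.isInfix hG
  unfold PureMorphic.tailMorphism at hm
  omega

theorem unmarked_suffix_le (hφ : NonErasing φ) (hr : Respects φ G) {R : α → Prop}
    (hR : ∀ b, R b → ∀ c ∈ φ b, R c)
    (hg : ∀ b, R b → ¬ GrowsAt (tailMorphism φ G) (Fintype.card α) b) :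
    ∃ K, ∀ b, R b → ∀ m t, t <:+ iterWord φ m [b] → Unmarked G t → t.length ≤ K := by
  refine ⟨Finset.univ.sup fun b => (iterWord (tailMorphism φ G) (Fintype.card α) [b]).length,
    fun b hb m t ht hG => ?_⟩
  have h1 := length_le_length_keep ht hG
  rw [hr.keep_iterWord] at h1
  have h2 := NonErasing.length_le_of_not_growsAt (φ := tailMorphism φ G) hφ.tailMorphism (R := R)
    (fun b hb c hc => hR b hb c ((keep_suffix _).subset hc)) hg hb m
  exact (h1.trans h2).trans (Finset.le_sup
    (f := fun b => (iterWord (tailMorphism φ G) (Fintype.card α) [b]).length) (Finset.mem_univ b))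

theorem almostPeriodic_iff_not_growsAt [DecidablePred (Returns φ s)] (h : Prolongable φ s)
    (hφ : NonErasing φ) :
    AlmostPeriodic (limitWord φ s) ↔ ∀ b ∈ iterWord φ (Fintype.card α + 1) [s],
      ¬ GrowsAt (tailMorphism φ (Returns φ s)) (Fintype.card α) b ∧
      ¬ GrowsAt (tailMorphism (fun b => (φ b).reverse) (Returns φ s)) (Fintype.card α) b := by
  have hr := respects_returns h.mem
  have hφ' : NonErasing fun b => (φ b).reverse := fun b => by simpa using hφ b
  have hrev : ∀ m b, iterWord (fun b => (φ b).reverse) m [b] = (iterWord φ m [b]).reverse :=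
    fun m b => iterWord_reverse φ m [b]
  rw [almostPeriodic_iff_runsLE h hφ]
  constructor
  · rintro ⟨L, hL⟩ b hb
    have hrun : ∀ m, RunsLE (Returns φ s) (iterWord φ m [b]) L := by
      intro m v hv
      have h1 := hv.trans (iterWord_letter_infix hb m)
      rw [← iterWord_add, ← limitWord_prefix h] at h1
      exact hL _ _ v h1
    refine ⟨not_growsAt_tailMorphism hφ hr hrun, not_growsAt_tailMorphism hφ' hr.reverse
      (L := L) fun m v hv hG => ?_⟩
    rw [hrev] at hv
    have := hrun m v.reverse (by simpa using List.reverse_infix.mpr hv)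
      fun c hc => hG c (by simpa using hc)
    simpa using this
  · intro hg
    have hR : ∀ b, b ∈ iterWord φ (Fintype.card α + 1) [s] → ∀ c ∈ φ b,
        c ∈ iterWord φ (Fintype.card α + 1) [s] := fun b hb c hc =>
      mem_iterWord_stable_source h.mem (Nat.le_succ _) (mem_iterWord_succ'.mpr ⟨b, hb, hc⟩)
    obtain ⟨K₁, h₁⟩ := unmarked_suffix_le hφ hr hR fun b hb => (hg b hb).1
    obtain ⟨K₂, h₂⟩ := unmarked_suffix_le hφ' hr.reverse
      (R := fun b => b ∈ iterWord φ (Fintype.card α + 1) [s])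
      (fun b hb c hc => hR b hb c (by simpa using hc)) fun b hb => (hg b hb).2
    -- Every window of x lies in an iterate of s, and `Returns φ s s` unfolds to the reachability of
    -- s from itself.
    refine ⟨_, fun i l v hv hG => runsLE_iterWord hR (K := max K₁ K₂)
      (k := Finset.univ.sup fun b => (φ b).length)
      (fun b => Finset.le_sup (f := fun b => (φ b).length) (Finset.mem_univ b))
      (fun b hb m t ht hG => ?_) (fun b hb m t ht hG => (h₁ b hb m t ht hG).trans
        (le_max_left _ _)) (i + l) s (returns_self h.mem) v
      (hv.trans (subword_limitWord_infix h i l _ le_rfl)) hG⟩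
    have := h₂ b hb m t.reverse (by rw [hrev]; exact List.reverse_suffix.mpr ht)
      fun c hc => hG c (by simpa using hc)
    rw [List.length_reverse] at this
    exact this.trans (le_max_right _ _)

end Criterion
/-! ### Reasoning about programs -/

section Programs

@[simp]
theorem State.reg_setReg (σ : State) (x v y : ℕ) :
    (σ.setReg x v).reg y = if y = x then v else σ.reg y := by
  simp [State.setReg, Function.update_apply]

@[simp]
theorem State.mem_setReg (σ : State) (x v : ℕ) : (σ.setReg x v).mem = σ.mem := rfl

@[simp]
theorem State.reg_setMem (σ : State) (a i v : ℕ) : (σ.setMem a i v).reg = σ.reg := rfl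

@[simp]
theorem State.mem_setMem (σ : State) (a i v b j : ℕ) :
    (σ.setMem a i v).mem b j = if b = a ∧ j = i then v else σ.mem b j := by
  by_cases hb : b = a
  · subst hb; simp [State.setMem, Function.update_apply]
  · simp [State.setMem, hb]

/-- Started in `σ`, the program `p` halts within `T` steps in a state that satisfies `Q`. -/
def Runs (p : Cmd) (σ : State) (T : ℕ) (Q : State → Prop) : Prop :=
  ∃ τ t, Exec p σ τ t ∧ t ≤ T ∧ Q τ

/-- The instructions of a list one after the other. -/
def block : List Cmd → Cmd
  | [] => .skip
  | p :: ps => .seq p (block ps)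

variable {σ : State} {T T' : ℕ} {Q Q' : State → Prop} {ps : List Cmd} {p q : Cmd} {x y z a : ℕ}

theorem Runs.mono (h : Runs p σ T Q') (hT : T ≤ T') (hQ : ∀ τ, Q' τ → Q τ) : Runs p σ T' Q := by
  obtain ⟨τ, t, he, ht, h⟩ := h
  exact ⟨τ, t, he, ht.trans hT, hQ τ h⟩

theorem Runs.nil (h : Q σ) : Runs (block []) σ 1 Q := ⟨σ, 1, .skip σ, le_rfl, h⟩

theorem Runs.cons (h : Runs p σ T Q') (h' : ∀ τ, Q' τ → Runs (block ps) τ T' Q) :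
    Runs (block (p :: ps)) σ (T' + T) Q := by
  obtain ⟨τ, t, he, ht, hQ⟩ := h
  obtain ⟨υ, t', he', ht', hQ'⟩ := h' τ hQ
  exact ⟨υ, t + t', .seq he he', by omega, hQ'⟩

theorem Runs.cons_of_exec {τ : State} {t : ℕ} (he : Exec p σ τ t)
    (h : Runs (block ps) τ T Q) : Runs (block (p :: ps)) σ (T + t) Q :=
  Runs.cons (Q' := fun υ => υ = τ) ⟨τ, t, he, le_rfl, rfl⟩ fun _ hυ => hυ ▸ h

theorem Runs.const {c : ℕ} (h : Runs (block ps) (σ.setReg x c) T Q) :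
    Runs (block (.const x c :: ps)) σ (T + 1) Q := .cons_of_exec (.const ..) h

theorem Runs.copy (h : Runs (block ps) (σ.setReg x (σ.reg y)) T Q) :
    Runs (block (.copy x y :: ps)) σ (T + 1) Q := .cons_of_exec (.copy ..) h

theorem Runs.add (h : Runs (block ps) (σ.setReg x (σ.reg y + σ.reg z)) T Q) :
    Runs (block (.add x y z :: ps)) σ (T + 1) Q := .cons_of_exec (.add ..) h

theorem Runs.sub (h : Runs (block ps) (σ.setReg x (σ.reg y - σ.reg z)) T Q) :
    Runs (block (.sub x y z :: ps)) σ (T + 1) Q := .cons_of_exec (.sub ..) h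

theorem Runs.load (h : Runs (block ps) (σ.setReg x (σ.mem a (σ.reg y))) T Q) :
    Runs (block (.load x a y :: ps)) σ (T + 1) Q := .cons_of_exec (.load ..) h

theorem Runs.store (h : Runs (block ps) (σ.setMem a (σ.reg x) (σ.reg y)) T Q) :
    Runs (block (.store a x y :: ps)) σ (T + 1) Q := .cons_of_exec (.store ..) h

/-- Both branches are expressed by one register update, so symbolic execution does not split. -/
theorem Runs.clearIf
    (h : Runs (block ps) (σ.setReg y (if σ.reg x ≠ 0 then 0 else σ.reg y)) T Q) :
    Runs (block (.cond x (.const y 0) .skip :: ps)) σ (T + 2) Q := by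
  refine .cons_of_exec ?_ h
  by_cases hx : σ.reg x = 0
  · have : σ.setReg y (if σ.reg x ≠ 0 then 0 else σ.reg y) = σ := by
      simp [hx, State.setReg]
    rw [this]
    exact .condFalse _ hx (.skip σ)
  · rw [if_pos hx]
    exact .condTrue _ hx (.const ..)

theorem Runs.loop_done (hx : σ.reg x = 0) (h : Q σ) : Runs (.loop x p) σ 1 Q :=
  ⟨σ, 1, .loopStop p hx, le_rfl, h⟩

theorem Runs.loop_step (hx : σ.reg x ≠ 0) (h : Runs p σ T Q')
    (h' : ∀ τ, Q' τ → Runs (.loop x p) τ T' Q) : Runs (.loop x p) σ (T' + (T + 1)) Q := by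
  obtain ⟨τ, t, he, ht, hQ⟩ := h
  obtain ⟨υ, t', he', ht', hQ'⟩ := h' τ hQ
  exact ⟨υ, t + t' + 1, .loopStep hx he he', by omega, hQ'⟩

/-- The states `σ` and `τ` have the same registers outside of `S`. -/
def RegsEq (S : List ℕ) (σ τ : State) : Prop := ∀ x, x ∉ S → τ.reg x = σ.reg x

end Programs

/-! ### Words in memory -/

section Memory

/-- The list `L` is stored in the array `A` from position `p` on. -/
def Holds (A : ℕ → ℕ) : ℕ → List ℕ → Prop
  | _, [] => True
  | p, c :: L => A p = c ∧ Holds A (p + 1) L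

/-- The position after `p`, in reading direction. -/
def next (rev : Bool) (p : ℕ) : ℕ := if rev then p - 1 else p + 1

/-- The list `L` is read in the array `A` from position `p` on, backwards if `rev` holds. -/
def Reads (rev : Bool) (A : ℕ → ℕ) : ℕ → List ℕ → Prop
  | _, [] => True
  | p, c :: L => A p = c ∧ Reads rev A (next rev p) L

theorem holds_append {A : ℕ → ℕ} {p : ℕ} {u v : List ℕ} :
    Holds A p (u ++ v) ↔ Holds A p u ∧ Holds A (p + u.length) v := by
  induction u generalizing p with
  | nil => simp [Holds]
  | cons c u ih =>
    rw [List.cons_append, Holds, Holds, ih, and_assoc, List.length_cons, add_right_comm p,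
      add_assoc p]

theorem holds_getD (u v : List ℕ) : Holds (fun i => (u ++ v).getD i 0) u.length v := by
  induction v generalizing u with
  | nil => trivial
  | cons c v ih =>
    refine ⟨by simp, ?_⟩
    have := ih (u ++ [c])
    rwa [List.length_append, List.append_assoc] at this

theorem Holds.reads {A : ℕ → ℕ} {p : ℕ} {v : List ℕ} (h : Holds A p v) : Reads false A p v := by
  induction v generalizing p with
  | nil => trivial
  | cons c v ih => exact ⟨h.1, ih h.2⟩

theorem Holds.reads_reverse {A : ℕ → ℕ} {p : ℕ} {v : List ℕ} (h : Holds A p v) :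
    Reads true A (p + v.length - 1) v.reverse := by
  induction v using List.reverseRecOn with
  | nil => trivial
  | append_singleton v c ih =>
    rw [holds_append] at h
    rw [List.reverse_append, List.length_append]
    exact ⟨h.2.1, ih h.1⟩

end Memory

/-! ### The program -/

section Program

/-- One letter: `r11` is replaced by `f c`, if `c` is marked, and by `r11 + f c` otherwise.
The weights `f` and the marks are in array `1` from `r4` and from `r5` on. -/
def scanBody (rev : Bool) : Cmd :=
  block [.load 13 0 12, .add 14 5 13, .load 14 1 14, .cond 14 (.const 11 0) .skip,
    .add 14 4 13, .load 14 1 14, .add 11 11 14,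
    if rev then .sub 12 12 3 else .add 12 12 3, .sub 9 9 3]

/-- One image word: its `scan` is written to array `1` at `r7`. -/
def letterBody (rev : Bool) : Cmd :=
  block [.load 9 0 8, if rev then .add 12 8 9 else .add 12 8 3, .add 8 8 9, .add 8 8 3,
    .const 11 0, .loop 9 (scanBody rev), .store 1 7 11, .add 7 7 3, .sub 6 6 3]

/-- The weights at `r4` are pulled back once, to `r4 + n`. -/
def layerBody (rev : Bool) : Cmd :=
  block [.add 7 4 1, .const 8 2, .copy 6 1, .loop 6 (letterBody rev), .add 4 4 1, .sub 10 10 3]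

/-- The weights at `r4` are pulled back `n + 1` times. -/
def phase (rev : Bool) : Cmd :=
  block [.add 10 1 3, .loop 10 (layerBody rev)]

variable {n : ℕ} {σ : State}

/-- The weights `f` are in array `1` from `a` on. -/
def Layer (σ : State) (a : ℕ) (f : Fin n → ℕ) : Prop := ∀ c : Fin n, σ.mem 1 (a + c) = f c

/-- A round costs 11 steps for the body and one for the test. -/
theorem runs_scan {g f : Fin n → ℕ} (rev : Bool) (w : List (Fin n)) (o m : ℕ)
    (h3 : σ.reg 3 = 1) (ho : σ.reg 4 = o) (hm : σ.reg 5 = m) (h9 : σ.reg 9 = w.length)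
    (hf : Layer σ o f) (hg : Layer σ m g)
    (hw : Reads rev (σ.mem 0) (σ.reg 12) (w.map Fin.val)) :
    Runs (.loop 9 (scanBody rev)) σ (12 * w.length + 1) fun τ =>
      τ.reg 11 = w.foldl (fun a c => if g c ≠ 0 then f c else a + f c) (σ.reg 11) ∧
      τ.mem = σ.mem ∧ RegsEq [9, 11, 12, 13, 14] σ τ := by
  induction w generalizing σ with
  | nil => exact .loop_done h9 ⟨rfl, rfl, fun _ _ => rfl⟩
  | cons c w ih =>
    have hc : σ.mem 0 (σ.reg 12) = c := hw.1
    have hbody : Runs (scanBody rev) σ 11 fun τ =>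
        τ.reg 11 = (if g c ≠ 0 then f c else σ.reg 11 + f c) ∧ τ.reg 9 = w.length ∧
        τ.reg 12 = next rev (σ.reg 12) ∧ τ.mem = σ.mem ∧ RegsEq [9, 11, 12, 13, 14] σ τ := by
      have hmc : σ.mem 1 (m + c) = g c := hg c
      have hoc : σ.mem 1 (o + c) = f c := hf c
      cases rev
      · refine .load <| .add <| .load <| .clearIf <| .add <| .load <| .add <| .add <| .sub <|
          .nil ⟨?_, ?_, ?_, ?_, ?_⟩
        · simp [hc, ho, hm, hmc, hoc]; split_ifs <;> simp
        · simp [h3, h9]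
        · simp [h3, next]
        · simp
        · intro x hx; simp at hx; simp [hx]
      · refine .load <| .add <| .load <| .clearIf <| .add <| .load <| .add <| .sub <| .sub <|
          .nil ⟨?_, ?_, ?_, ?_, ?_⟩
        · simp [hc, ho, hm, hmc, hoc]; split_ifs <;> simp
        · simp [h3, h9]
        · simp [h3, next]
        · simp
        · intro x hx; simp at hx; simp [hx]
    refine (Runs.loop_step (by simp [h9]) hbody fun τ ⟨h1, h2, h12, hmem, hr⟩ =>
      (ih (σ := τ) ?_ ?_ ?_ h2 ?_ ?_ ?_).mono le_rfl fun υ ⟨h1', hmem', hr'⟩ =>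
        ⟨?_, hmem'.trans hmem, fun x hx => (hr' x hx).trans (hr x hx)⟩).mono
        (by simp; omega) fun _ h => h
    · rw [hr 3 (by simp), h3]
    · rw [hr 4 (by simp), ho]
    · rw [hr 5 (by simp), hm]
    · unfold Layer; rw [hmem]; exact hf
    · unfold Layer; rw [hmem]; exact hg
    · rw [hmem, h12]; exact hw.2
    · rw [h1', h1, List.foldl_cons]

end Program
-- Pulling weights back through the images
section Program

variable {n : ℕ} {σ : State}

/-- The presentation of the image words of the letters in `bs`. -/
def encodeImages (φ : Fin n → List (Fin n)) (bs : List (Fin n)) : List ℕ :=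
  bs.flatMap fun b => (φ b).length :: (φ b).map Fin.val

/-- The word `w`, or its reversal. -/
def orient (rev : Bool) (w : List (Fin n)) : List (Fin n) := if rev then w.reverse else w

/-- One round of the program: weights are pulled back along the suffixes of the image words that
start at the last letter with `g ≠ 0`. -/
def pullStep (rev : Bool) (φ : Fin n → List (Fin n)) (g f : Fin n → ℕ) (b : Fin n) : ℕ :=
  scan (fun c => g c ≠ 0) f (orient rev (φ b))

/-- The write position `r7` starts beyond the weights and the marks and only increases, so neither
is overwritten. -/
theorem runs_letters {φ : Fin n → List (Fin n)} {k : ℕ} (hk : ∀ b, (φ b).length ≤ k)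
    {g f : Fin n → ℕ} (rev : Bool) (bs : List (Fin n)) (o m : ℕ)
    (h3 : σ.reg 3 = 1) (ho : σ.reg 4 = o) (hm : σ.reg 5 = m) (h6 : σ.reg 6 = bs.length)
    (hf : Layer σ o f) (hg : Layer σ m g) (how : o + n ≤ σ.reg 7) (hmw : m + n ≤ σ.reg 7)
    (hw : Holds (σ.mem 0) (σ.reg 8) (encodeImages φ bs)) :
    Runs (.loop 6 (letterBody rev)) σ (bs.length * (12 * k + 11) + 1) fun τ =>
      (∀ j (hj : j < bs.length), τ.mem 1 (σ.reg 7 + j) = pullStep rev φ g f bs[j]) ∧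
      (∀ i < σ.reg 7, τ.mem 1 i = σ.mem 1 i) ∧ τ.mem 0 = σ.mem 0 ∧
      RegsEq [6, 7, 8, 9, 11, 12, 13, 14] σ τ := by
  induction bs generalizing σ with
  | nil =>
    refine Runs.mono (Q' := fun τ => τ = σ) (.loop_done h6 rfl) (by simp) ?_
    rintro _ rfl
    exact ⟨by simp, fun _ _ => rfl, rfl, fun _ _ => rfl⟩
  | cons b bs ih =>
    rw [encodeImages, List.flatMap_cons, holds_append] at hw
    obtain ⟨⟨hlen, hword⟩, hrest⟩ := hw
    rw [List.length_cons, List.length_map] at hrest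
    have hbody : Runs (letterBody rev) σ (12 * (φ b).length + 10) fun τ =>
        (∀ i, τ.mem 1 i = if i = σ.reg 7 then pullStep rev φ g f b else σ.mem 1 i) ∧
        τ.mem 0 = σ.mem 0 ∧ τ.reg 6 = bs.length ∧ τ.reg 7 = σ.reg 7 + 1 ∧
        τ.reg 8 = σ.reg 8 + ((φ b).length + 1) ∧
        RegsEq [6, 7, 8, 9, 11, 12, 13, 14] σ τ := by
      cases rev
      · refine (Runs.load <| .add <| .add <| .add <| .const <| .cons
          (runs_scan (g := g) (f := f) false (φ b) o m ?_ ?_ ?_ ?_ ?_ ?_ ?_)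
          fun τ ⟨h1, hmem, hr⟩ => .store <| .add <| .sub <| .nil
            ⟨?_, ?_, ?_, ?_, ?_, ?_⟩).mono (by omega) fun _ h => h
        · simp [h3]
        · simp [ho]
        · simp [hm]
        · simp [hlen]
        · simpa [Layer] using hf
        · simpa [Layer] using hg
        · simpa [h3] using hword.reads
        · simp [hmem, h1, hr 7, pullStep, orient, scan]
        · funext i; simp [hmem]
        · simp [hr 6, hr 3, h3, h6]
        · simp [hr 7, hr 3, h3]
        · simp [hr 8, h3, hlen]; omega
        · intro x hx; simp at hx; simp [hx, hr x]
      · refine (Runs.load <| .add <| .add <| .add <| .const <| .cons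
          (runs_scan (g := g) (f := f) true (φ b).reverse o m ?_ ?_ ?_ ?_ ?_ ?_ ?_)
          fun τ ⟨h1, hmem, hr⟩ => .store <| .add <| .sub <| .nil
            ⟨?_, ?_, ?_, ?_, ?_, ?_⟩).mono (by simp; omega) fun _ h => h
        · simp [h3]
        · simp [ho]
        · simp [hm]
        · simp [hlen]
        · simpa [Layer] using hf
        · simpa [Layer] using hg
        · have := hword.reads_reverse
          -- Backward reading starts at the last letter, whose address is that of the length cell
          -- plus the length.
          rw [List.length_map, show σ.reg 8 + 1 + (φ b).length - 1 = σ.reg 8 + (φ b).length by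
            omega] at this
          simpa [hlen] using this
        · simp [hmem, h1, hr 7, pullStep, orient, scan]
        · funext i; simp [hmem]
        · simp [hr 6, hr 3, h3, h6]
        · simp [hr 7, hr 3, h3]
        · simp [hr 8, h3, hlen]; omega
        · intro x hx; simp at hx; simp [hx, hr x]
    refine (Runs.loop_step (by simp [h6]) hbody fun τ ⟨h1, hm0, h6', h7, h8, hr⟩ =>
      (ih (σ := τ) ?_ ?_ ?_ h6' ?_ ?_ ?_ ?_ ?_).mono le_rfl fun υ ⟨h1', hlt, hm0', hr'⟩ =>
        ⟨?_, ?_, hm0'.trans hm0, fun x hx => (hr' x hx).trans (hr x hx)⟩).mono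
        (by have := hk b; rw [List.length_cons, Nat.succ_mul bs.length]; omega) fun _ h => h
    · rw [hr 3 (by simp), h3]
    · rw [hr 4 (by simp), ho]
    · rw [hr 5 (by simp), hm]
    · intro c; rw [h1, if_neg (by omega)]; exact hf c
    · intro c; rw [h1, if_neg (by omega)]; exact hg c
    · omega
    · omega
    · rw [hm0, h8]; exact hrest
    · intro j hj
      rcases j with - | j
      · rw [hlt _ (by omega), h1]; simp
      · have := h1' j (by simpa using hj)
        rw [h7] at this
        rw [show σ.reg 7 + (j + 1) = σ.reg 7 + 1 + j by omega, this]
        rfl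
    · intro i hi
      rw [hlt i (by omega), h1, if_neg (by omega)]

theorem runs_layers {φ : Fin n → List (Fin n)} {k : ℕ} (hk : ∀ b, (φ b).length ≤ k)
    {g f : Fin n → ℕ} (rev : Bool) (N : ℕ) (o m : ℕ) (h1 : σ.reg 1 = n)
    (h3 : σ.reg 3 = 1) (ho : σ.reg 4 = o) (hm : σ.reg 5 = m) (h10 : σ.reg 10 = N)
    (hf : Layer σ o f) (hg : Layer σ m g) (hmo : m ≤ o)
    (hw : Holds (σ.mem 0) 2 (encodeImages φ (List.finRange n))) :
    Runs (.loop 10 (layerBody rev)) σ (N * (n * (12 * k + 11) + 8) + 1) fun τ =>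
      (∀ j ≤ N, Layer τ (o + j * n) ((pullStep rev φ g)^[j] f)) ∧
      (∀ i < o + n, τ.mem 1 i = σ.mem 1 i) ∧ τ.mem 0 = σ.mem 0 ∧ τ.reg 4 = o + N * n ∧
      RegsEq [4, 6, 7, 8, 9, 10, 11, 12, 13, 14] σ τ := by
  induction N generalizing σ o f with
  | zero =>
    rw [Nat.zero_mul (n * _ + 8)]
    refine .loop_done h10 ⟨fun j hj => ?_, fun _ _ => rfl, rfl, by simpa using ho, fun _ _ => rfl⟩
    obtain rfl : j = 0 := by omega
    simpa using hf
  | succ N ih =>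
    have hbody : Runs (layerBody rev) σ (n * (12 * k + 11) + 7) fun τ =>
        Layer τ (o + n) (pullStep rev φ g f) ∧ (∀ i < o + n, τ.mem 1 i = σ.mem 1 i) ∧
        τ.mem 0 = σ.mem 0 ∧ τ.reg 4 = o + n ∧ τ.reg 10 = N ∧
        RegsEq [4, 6, 7, 8, 9, 10, 11, 12, 13, 14] σ τ := by
      refine (Runs.add <| .const <| .copy <| .cons
        (runs_letters hk (g := g) (f := f) rev (List.finRange n) o m ?_ ?_ ?_ ?_ ?_ ?_ ?_ ?_ ?_)
        fun τ ⟨hτ, hlt, hmem, hr⟩ => .add <| .sub <| .nil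
          ⟨?_, ?_, ?_, ?_, ?_, ?_⟩).mono (by simp; omega) fun _ h => h
      · simp [h3]
      · simp [ho]
      · simp [hm]
      · simp [h1]
      · simpa [Layer] using hf
      · simpa [Layer] using hg
      · simp [ho, h1]
      · simpa [ho, h1] using hmo
      · simpa using hw
      · intro c
        have := hτ c (by simp)
        simpa [ho, h1] using this
      · simpa [ho, h1] using hlt
      · simpa using hmem
      · simp [hr 4, hr 1, ho, h1]
      · simp [hr 10, hr 3, h10, h3]
      · intro x hx; simp at hx; simp [hx, hr x]
    refine (Runs.loop_step (by simp [h10]) hbody fun τ ⟨hτ, hlt, hmem, h4, h10', hr⟩ =>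
      (ih (σ := τ) (o := o + n) (f := pullStep rev φ g f) ?_ ?_ h4 ?_ h10' hτ ?_ (by omega)
        ?_).mono le_rfl fun υ ⟨hυ, hlt', hmem', h4', hr'⟩ =>
        ⟨?_, ?_, hmem'.trans hmem, ?_, fun x hx => (hr' x hx).trans (hr x hx)⟩).mono
        (by rw [Nat.succ_mul N]; omega) fun _ h => h
    · rw [hr 1 (by simp), h1]
    · rw [hr 3 (by simp), h3]
    · rw [hr 5 (by simp), hm]
    · intro c; rw [hlt _ (by omega)]; exact hg c
    · rw [hmem]; exact hw
    · rintro (- | j) hj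
      · intro c
        rw [Nat.zero_mul, add_zero, hlt' _ (by omega), hlt _ (by omega)]
        exact hf c
      · have := hυ j (by omega)
        rwa [add_assoc, add_comm n, ← Nat.succ_mul j] at this
    · intro i hi
      rw [hlt' i (by omega), hlt i hi]
    · rw [h4', Nat.succ_mul N]; omega

/-- Both of the last two layers are recorded, since growth is their difference. -/
theorem runs_phase {φ : Fin n → List (Fin n)} {k : ℕ} (hk : ∀ b, (φ b).length ≤ k)
    {g f : Fin n → ℕ} (rev : Bool) (o m : ℕ) (h1 : σ.reg 1 = n)
    (h3 : σ.reg 3 = 1) (ho : σ.reg 4 = o) (hm : σ.reg 5 = m)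
    (hf : Layer σ o f) (hg : Layer σ m g) (hmo : m ≤ o)
    (hw : Holds (σ.mem 0) 2 (encodeImages φ (List.finRange n))) :
    Runs (phase rev) σ ((n + 1) * (n * (12 * k + 11) + 8) + 3) fun τ =>
      Layer τ (o + n * n) ((pullStep rev φ g)^[n] f) ∧
      Layer τ (o + n * n + n) ((pullStep rev φ g)^[n + 1] f) ∧
      (∀ i < o + n, τ.mem 1 i = σ.mem 1 i) ∧ τ.mem 0 = σ.mem 0 ∧ τ.reg 4 = o + n * n + n ∧
      RegsEq [4, 6, 7, 8, 9, 10, 11, 12, 13, 14] σ τ := by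
  refine (Runs.add <| .cons (runs_layers hk (g := g) (f := f) rev (n + 1) o m ?_ ?_ ?_ ?_ ?_ ?_ ?_
    hmo ?_) fun τ ⟨hτ, hlt, hmem, h4, hr⟩ => .nil ⟨hτ n (by omega), ?_, ?_, ?_, ?_, ?_⟩).mono
    (by omega) fun _ h => h
  · simp [h1]
  · simp [h3]
  · simp [ho]
  · simp [hm]
  · simp [h1, h3]
  · simpa [Layer] using hf
  · simpa [Layer] using hg
  · simpa using hw
  · have := hτ (n + 1) le_rfl
    rwa [Nat.succ_mul n, ← add_assoc] at this
  · simpa using hlt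
  · simpa using hmem
  · rw [h4, Nat.succ_mul n, ← add_assoc]
  · intro x hx
    rw [hr x hx]
    simp at hx
    simp [hx]

end Program
-- Assembling the decision program
section Program

/-- The array `1` is filled from `r4` to `r4 + n` with the numbers that `p` puts into `r11`. -/
def fill (p : Cmd) : Cmd :=
  block [.copy 6 1, .copy 7 4, .loop 6 (block [p, .store 1 7 11, .add 7 7 3, .sub 6 6 3])]

/-- The states `σ` and `τ` agree up to the work registers of `fill` and the array `1` from `o`. -/
def FillEq (o : ℕ) (σ τ : State) : Prop :=
  (∀ i < o, τ.mem 1 i = σ.mem 1 i) ∧ τ.mem 0 = σ.mem 0 ∧ RegsEq [6, 7, 11, 12, 13, 14] σ τ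

theorem FillEq.trans {o : ℕ} {σ τ υ : State} (h : FillEq o σ τ) (h' : FillEq o τ υ) :
    FillEq o σ υ :=
  ⟨fun i hi => (h'.1 i hi).trans (h.1 i hi), h'.2.1.trans h.2.1,
    fun x hx => (h'.2.2 x hx).trans (h.2.2 x hx)⟩

theorem runs_fill {σ : State} {n o T : ℕ} {p : Cmd} {v : ℕ → ℕ} (h1 : σ.reg 1 = n)
    (h3 : σ.reg 3 = 1) (h4 : σ.reg 4 = o)
    (hp : ∀ j < n, ∀ τ, FillEq o σ τ → τ.reg 6 = n - j → Runs p τ T fun υ =>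
      υ.mem = τ.mem ∧ υ.reg 11 = v j ∧ RegsEq [11, 12, 13, 14] τ υ) :
    Runs (fill p) σ (n * (T + 5) + 4) fun τ =>
      (∀ j < n, τ.mem 1 (o + j) = v j) ∧ FillEq o σ τ := by
  have key : ∀ r j τ, j + r = n → FillEq o σ τ → τ.reg 6 = r → τ.reg 7 = o + j →
      Runs (.loop 6 (block [p, .store 1 7 11, .add 7 7 3, .sub 6 6 3])) τ (r * (T + 5) + 1)
      fun υ => (∀ i, j ≤ i → i < n → υ.mem 1 (o + i) = v i) ∧
        (∀ i < o + j, υ.mem 1 i = τ.mem 1 i) ∧ FillEq o σ υ := by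
    intro r
    induction r with
    | zero =>
      intro j τ hj hτ h6 h7
      refine Runs.mono (Q' := fun υ => υ = τ) (.loop_done h6 rfl) (by simp) ?_
      rintro _ rfl
      exact ⟨fun i h h' => by omega, fun _ _ => rfl, hτ⟩
    | succ r ih =>
      intro j τ hj hτ h6 h7
      have hbody : Runs (block [p, .store 1 7 11, .add 7 7 3, .sub 6 6 3]) τ (T + 4) fun υ =>
          (∀ i, υ.mem 1 i = if i = o + j then v j else τ.mem 1 i) ∧ FillEq o σ υ ∧
          υ.reg 6 = r ∧ υ.reg 7 = o + (j + 1) := by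
        refine (Runs.cons (hp j (by omega) τ hτ (by omega)) fun υ ⟨hmem, hv, hr⟩ =>
          .store <| .add <| .sub <| .nil
            ⟨?_, hτ.trans ⟨?_, ?_, ?_⟩, ?_, ?_⟩).mono (by omega) fun _ h => h
        · simp [hmem, hr 7, h7, hv]
        · intro i hi
          simp [hmem, hr 7, h7]
          omega
        · funext i; simp [hmem]
        · intro x hx; simp at hx; simp [hx, hr x]
        · simp [hr 6, hr 3, h6, hτ.2.2 3, h3]
        · simp [hr 7, hr 3, h7, hτ.2.2 3, h3, add_assoc]
      refine (Runs.loop_step (by omega) hbody fun υ ⟨hmem, hυ, h6', h7'⟩ =>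
        (ih (j + 1) υ (by omega) hυ h6' h7').mono le_rfl fun ρ ⟨hv, hlt, hρ⟩ =>
          ⟨?_, ?_, hρ⟩).mono (by rw [Nat.succ_mul r]; omega) fun _ h => h
      · intro i hji hi
        rcases Nat.eq_or_lt_of_le hji with rfl | hlt'
        · rw [hlt _ (by omega), hmem, if_pos rfl]
        · exact hv i hlt' hi
      · intro i hi
        rw [hlt i (by omega), hmem, if_neg (by omega)]
  refine (Runs.copy <| .copy <| .cons (key n 0 _ (by omega) ⟨?_, ?_, ?_⟩ ?_ ?_)
    fun τ ⟨hv, _, hτ⟩ => .nil ⟨fun j hj => hv j (by omega) hj, hτ⟩).mono (by omega) fun _ h => h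
  · intro i hi; simp
  · simp
  · intro x hx; simp at hx; simp [hx]
  · simp [h1]
  · simp [h4]

variable {n : ℕ} {σ : State} {φ : Fin n → List (Fin n)} {s : Fin n} {k : ℕ}

/-- The input has been read, and the first `n` cells of array `1` are still zero. -/
structure Ready (φ : Fin n → List (Fin n)) (s : Fin n) (σ : State) : Prop where
  reg1 : σ.reg 1 = n
  reg2 : σ.reg 2 = s
  reg3 : σ.reg 3 = 1
  images : Holds (σ.mem 0) 2 (encodeImages φ (List.finRange n))
  zero : ∀ i < n, σ.mem 1 i = 0

/-- The input is read, and the letters from which `s` can be reached are marked. -/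
def markPart : Cmd :=
  block [.load 1 0 0, .const 3 1, .load 2 0 3, .copy 4 1, .add 13 4 2, .store 1 13 3, phase false]

/-- The constant weight `1` is pulled back `n` and `n + 1` times along suffixes or prefixes. -/
def growthPart (rev : Bool) : Cmd :=
  block [.add 4 4 1, fill (.copy 11 3), phase rev]

/-- The combined growth in the last step, for the letter number `n - r6`. -/
def growthDifference : Cmd :=
  block [.sub 12 1 6, .add 13 15 12, .load 11 1 13, .sub 13 13 1, .load 14 1 13, .sub 11 11 14,
    .add 13 16 12, .load 14 1 13, .add 11 11 14, .sub 13 13 1, .load 14 1 13, .sub 11 11 14]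

/-- The output is `1` if no letter reachable from `s` grows. -/
def answerPart : Cmd :=
  block [.add 4 4 1, fill growthDifference, .const 5 0, phase false, .add 13 4 2, .load 14 1 13,
    .sub 0 3 14]

/-- The program that decides almost periodicity. -/
def decider : Cmd :=
  block [markPart, .copy 5 4, growthPart false, .copy 15 4, growthPart true, .copy 16 4,
    answerPart]

/-- A bound for the running time of `phase`. -/
def phaseTime (n k : ℕ) : ℕ := (n + 1) * (n * (12 * k + 11) + 8) + 3

/-- Cells 0 to n-1 of array `1` stay zero and serve as the empty set of marks (`r5 = 0`); the
indicator of s is placed from cell n on. -/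
theorem runs_markPart (hk : ∀ b, (φ b).length ≤ k) :
    Runs markPart (initState (encode φ s)) (phaseTime n k + 7) fun τ =>
      Ready φ s τ ∧ n ≤ τ.reg 4 ∧
      Layer τ (τ.reg 4) ((pullStep false φ 0)^[n + 1] fun b => if b = s then 1 else 0) := by
  have hn := s.isLt
  have himg : Holds (fun i => (encode φ s).getD i 0) 2 (encodeImages φ (List.finRange n)) :=
    holds_getD [n, s.val] _
  refine (Runs.load <| .const <| .load <| .copy <| .add <| .store <| .cons
    (runs_phase hk (g := 0) (f := fun b => if b = s then 1 else 0) false n 0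
      ?_ ?_ ?_ ?_ ?_ ?_ ?_ ?_) fun τ ⟨_, hl, hlt, hmem, h4, hr⟩ => .nil
      ⟨⟨?_, ?_, ?_, ?_, ?_⟩, ?_, ?_⟩).mono (by unfold phaseTime; omega) fun _ h => h
  · simp [initState, encode]
  · simp
  · simp [initState, encode]
  · simp [initState]
  · intro c
    simp [initState, encode, Fin.ext_iff]
  · intro c
    simp [initState, encode]
    omega
  · omega
  · exact himg
  · rw [hr 1 (by simp)]; simp [initState, encode]
  · rw [hr 2 (by simp)]; simp [initState, encode]
  · rw [hr 3 (by simp)]; simp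
  · rw [hmem]; exact himg
  · intro i hi
    rw [hlt i (by omega)]
    simp [initState, encode]
    omega
  · omega
  · rw [h4]; exact hl

theorem runs_growthPart (hk : ∀ b, (φ b).length ≤ k) {g : Fin n → ℕ} (rev : Bool) {o m : ℕ}
    (hσ : Ready φ s σ) (h4 : σ.reg 4 = o) (h5 : σ.reg 5 = m) (hmo : m ≤ o) (hno : n ≤ o)
    (hg : Layer σ m g) :
    Runs (growthPart rev) σ (phaseTime n k + n * 6 + 6) fun τ =>
      Ready φ s τ ∧ o + n ≤ τ.reg 4 - n ∧
      Layer τ (τ.reg 4 - n) ((pullStep rev φ g)^[n] fun _ => 1) ∧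
      Layer τ (τ.reg 4) ((pullStep rev φ g)^[n + 1] fun _ => 1) ∧
      (∀ i < o + n, τ.mem 1 i = σ.mem 1 i) ∧
      RegsEq [4, 6, 7, 8, 9, 10, 11, 12, 13, 14] σ τ := by
  refine (Runs.add <| .cons (runs_fill (n := n) (o := o + n) (T := 1) (v := fun _ => 1)
    ?_ ?_ ?_ ?_) fun τ ⟨hv, hlt, hmem, hr⟩ => .cons
    (runs_phase hk (g := g) (f := fun _ => 1) rev (o + n) m
      ?_ ?_ ?_ ?_ ?_ ?_ ?_ ?_) fun υ ⟨hl, hl', hlt', hmem', h4', hr'⟩ => .nil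
      ⟨⟨?_, ?_, ?_, ?_, ?_⟩, ?_, ?_, ?_, ?_, ?_⟩).mono (by unfold phaseTime; omega) fun _ h => h
  · simp [hσ.reg1]
  · simp [hσ.reg3]
  · simp [h4, hσ.reg1]
  · intro j hj τ ⟨_, _, hr⟩ _
    refine ⟨_, 1, .copy τ 11 3, le_rfl, by simp, ?_, ?_⟩
    · simp [hr 3, hσ.reg3]
    · intro x hx; simp at hx; simp [hx]
  · simp [hr 1, hσ.reg1]
  · simp [hr 3, hσ.reg3]
  · simp [hr 4, h4, hσ.reg1]
  · simp [hr 5, h5]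
  · exact fun c => hv c c.isLt
  · intro c
    rw [hlt _ (by omega)]
    exact hg c
  · omega
  · rw [hmem]; exact hσ.images
  · simp [hr' 1, hr 1, hσ.reg1]
  · simp [hr' 2, hr 2, hσ.reg2]
  · simp [hr' 3, hr 3, hσ.reg3]
  · rw [hmem', hmem]; exact hσ.images
  · intro i hi
    rw [hlt' _ (by omega), hlt _ (by omega)]
    exact hσ.zero i hi
  · omega
  · rw [h4', Nat.add_sub_cancel]; exact hl
  · rw [h4']; exact hl'
  · intro i hi
    rw [hlt' _ (by omega), hlt _ (by omega)]
    rfl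
  · intro x hx
    rw [hr' x hx]
    simp at hx
    rw [hr x (by simp [hx])]
    simp [hx]

theorem runs_answerPart (hk : ∀ b, (φ b).length ≤ k) {f₀ f₁ f₀' f₁' : Fin n → ℕ} {o a a' : ℕ}
    (hσ : Ready φ s σ) (h4 : σ.reg 4 = o) (h15 : σ.reg 15 = a) (h16 : σ.reg 16 = a')
    (hno : n ≤ o) (hna : n ≤ a) (hao : a ≤ o) (hna' : n ≤ a') (hao' : a' ≤ o)
    (hf₀ : Layer σ (a - n) f₀) (hf₁ : Layer σ a f₁)
    (hf₀' : Layer σ (a' - n) f₀') (hf₁' : Layer σ a' f₁') :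
    Runs answerPart σ (phaseTime n k + n * 18 + 10) fun τ =>
      τ.reg 0 = 1 - (pullStep false φ 0)^[n + 1] (fun b => f₁ b - f₀ b + f₁' b - f₀' b) s := by
  have hn := s.isLt
  refine (Runs.add <| .cons (runs_fill (n := n) (o := o + n) (T := 13)
    (v := fun j => σ.mem 1 (a + j) - σ.mem 1 (a + j - n) + σ.mem 1 (a' + j) -
      σ.mem 1 (a' + j - n)) ?_ ?_ ?_ ?_) fun τ ⟨hv, hlt, hmem, hr⟩ => .const <| .cons
    (runs_phase hk (g := 0) (f := fun b => f₁ b - f₀ b + f₁' b - f₀' b) false (o + n) 0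
      ?_ ?_ ?_ ?_ ?_ ?_ ?_ ?_) fun υ ⟨_, hl, _, _, h4', hr'⟩ => .add <| .load <| .sub <| .nil
      ?_).mono (by unfold phaseTime; omega) fun _ h => h
  · simp [hσ.reg1]
  · simp [hσ.reg3]
  · simp [h4, hσ.reg1]
  · intro j hj τ ⟨hlt, _, hr⟩ h6
    have h1 : τ.reg 1 = n := by simp [hr 1, hσ.reg1]
    have h15' : τ.reg 15 = a := by simp [hr 15, h15]
    have h16' : τ.reg 16 = a' := by simp [hr 16, h16]
    have hj' : n - (n - j) = j := by omega
    have e1 := hlt (a + j) (by omega)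
    have e2 := hlt (a + j - n) (by omega)
    have e3 := hlt (a' + j) (by omega)
    have e4 := hlt (a' + j - n) (by omega)
    simp only [State.mem_setReg] at e1 e2 e3 e4
    refine .sub <| .add <| .load <| .sub <| .load <| .sub <| .add <| .load <| .add <| .sub <|
      .load <| .sub <| .nil ⟨?_, ?_, ?_⟩
    · simp
    · simp [h1, h15', h16', h6, hj', e1, e2, e3, e4]
    · intro x hx; simp at hx; simp [hx]
  · simp [hr 1, hσ.reg1]
  · simp [hr 3, hσ.reg3]
  · simp [hr 4, h4, hσ.reg1]
  · simp
  · intro c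
    have e1 := hf₀ c
    have e2 := hf₀' c
    rw [show a - n + c = a + c - n by omega] at e1
    rw [show a' - n + c = a' + c - n by omega] at e2
    simp only [State.mem_setReg]
    rw [hv c c.isLt, e1, e2, hf₁ c, hf₁' c]
  · intro c
    simp only [State.mem_setReg, Pi.zero_apply, zero_add]
    rw [hlt _ (by omega)]
    exact hσ.zero c c.isLt
  · omega
  · simp only [State.mem_setReg]
    rw [hmem]
    exact hσ.images
  · have h2 : υ.reg 2 = s := by simp [hr' 2, hr 2, hσ.reg2]
    have h3 : υ.reg 3 = 1 := by simp [hr' 3, hr 3, hσ.reg3]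
    have := hl s
    rw [← h4'] at this
    simp [h2, h3, this]

theorem runs_decider (hk : ∀ b, (φ b).length ≤ k) {g : Fin n → ℕ}
    (hg : g = (pullStep false φ 0)^[n + 1] fun b => if b = s then 1 else 0) :
    Runs decider (initState (encode φ s)) (4 * phaseTime n k + n * 30 + 33) fun τ =>
      τ.reg 0 = 1 - (pullStep false φ 0)^[n + 1] (fun b =>
        (pullStep false φ g)^[n + 1] (fun _ => 1) b - (pullStep false φ g)^[n] (fun _ => 1) b +
        (pullStep true φ g)^[n + 1] (fun _ => 1) b - (pullStep true φ g)^[n] (fun _ => 1) b)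
        s := by
  subst hg
  -- Layer addresses are saved in registers above 3, which `Ready` does not mention.
  have hready : ∀ {τ : State} (x v : ℕ), 3 < x → Ready φ s τ → Ready φ s (τ.setReg x v) :=
    fun x v hx h => ⟨by simp [h.reg1, show 1 ≠ x by omega], by simp [h.reg2, show 2 ≠ x by omega],
      by simp [h.reg3, show 3 ≠ x by omega], h.images, h.zero⟩
  refine (Runs.cons (runs_markPart hk) fun τ₁ ⟨hτ₁, hn₁, hl₁⟩ => .copy <| .cons
    (runs_growthPart hk false (o := τ₁.reg 4) (m := τ₁.reg 4) (hready _ _ (by omega) hτ₁)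
      (by simp) (by simp) le_rfl hn₁ hl₁) fun τ₂ ⟨hτ₂, hn₂, hp₂, hl₂, hlt₂, hr₂⟩ => .copy <| .cons
    (runs_growthPart hk true (o := τ₂.reg 4) (m := τ₁.reg 4) (hready _ _ (by omega) hτ₂)
      (by simp) (by simp [hr₂ 5]) (by omega) (by omega) ?_)
      fun τ₃ ⟨hτ₃, hn₃, hp₃, hl₃, hlt₃, hr₃⟩ => .copy <| .cons
    (runs_answerPart hk (o := τ₃.reg 4) (a := τ₂.reg 4) (a' := τ₃.reg 4)
      (hready _ _ (by omega) hτ₃) (by simp) (by simp [hr₃ 15]) (by simp) (by omega) (by omega)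
      (by omega) (by omega) le_rfl ?_ ?_ hp₃ hl₃) fun _ h => .nil h).mono (by omega) fun _ h => h
  · intro c
    rw [State.mem_setReg, hlt₂ _ (by omega)]
    exact hl₁ c
  · intro c
    rw [State.mem_setReg, hlt₃ _ (by omega)]
    exact hp₂ c
  · intro c
    rw [State.mem_setReg, hlt₃ _ (by omega)]
    exact hl₂ c

end Program

/-! ### Correctness of the answer -/

section Correctness

variable {n : ℕ} {φ : Fin n → List (Fin n)} {s : Fin n}

theorem pullStep_eq_pull (rev : Bool) (g : Fin n → ℕ) (f : Fin n → ℕ) :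
    pullStep rev φ g f = pull (tailMorphism (fun b => orient rev (φ b)) fun c => g c ≠ 0) f :=
  funext fun _ => scan_eq_sum f _

theorem pullStep_iterate (rev : Bool) (g f : Fin n → ℕ) (m : ℕ) (b : Fin n) :
    (pullStep rev φ g)^[m] f b =
      ((iterWord (tailMorphism (fun b => orient rev (φ b)) fun c => g c ≠ 0) m [b]).map f).sum := by
  rw [← pull_iterate, funext (pullStep_eq_pull rev g)]

theorem pullStep_zero_iterate (f : Fin n → ℕ) (m : ℕ) (b : Fin n) :
    (pullStep false φ 0)^[m] f b = ((iterWord φ m [b]).map f).sum := by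
  rw [pullStep_iterate]
  congr 3
  exact funext fun b => keep_of_unmarked fun c _ => by simp

theorem pullStep_one_iterate (rev : Bool) (g : Fin n → ℕ) (m : ℕ) (b : Fin n) :
    (pullStep rev φ g)^[m] (fun _ => 1) b =
      (iterWord (tailMorphism (fun b => orient rev (φ b)) fun c => g c ≠ 0) m [b]).length := by
  rw [pullStep_iterate]
  simp

/-- The last pullback sums the growths over the letters of φ^(n+1)(s); a sum of natural numbers
vanishes iff every term does. -/
theorem almostPeriodic_iff_answer_eq_zero (hφ : NonErasing φ) (hs : Prolongable φ s)
    {g : Fin n → ℕ} (hg : g = (pullStep false φ 0)^[n + 1] fun b => if b = s then 1 else 0) :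
    AlmostPeriodic (limitWord φ s) ↔ (pullStep false φ 0)^[n + 1] (fun b =>
      (pullStep false φ g)^[n + 1] (fun _ => 1) b - (pullStep false φ g)^[n] (fun _ => 1) b +
      (pullStep true φ g)^[n + 1] (fun _ => 1) b - (pullStep true φ g)^[n] (fun _ => 1) b)
      s = 0 := by
  have hG : (fun c => g c ≠ 0) = Returns φ s := by
    funext b
    simp only [hg, pullStep_zero_iterate, Returns, Fintype.card_fin]
    simp [List.sum_eq_zero_iff]
  let _ : DecidablePred (Returns φ s) := hG ▸ inferInstanceAs (DecidablePred fun c => g c ≠ 0)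
  -- Lengths do not decrease, so the truncated subtractions are exact and the combined growth
  -- vanishes iff both growths do.
  have hmono : ∀ rev b, (pullStep rev φ g)^[n] (fun _ => 1) b ≤
      (pullStep rev φ g)^[n + 1] (fun _ => 1) b := by
    intro rev b
    rw [pullStep_one_iterate, pullStep_one_iterate]
    refine NonErasing.length_mono (NonErasing.tailMorphism fun b => ?_) [b] (Nat.le_succ n)
    cases rev <;> simpa [orient] using hφ b
  have hgrow : ∀ rev b, GrowsAt (tailMorphism (fun b => orient rev (φ b)) (Returns φ s)) n b ↔
      (pullStep rev φ g)^[n] (fun _ => 1) b < (pullStep rev φ g)^[n + 1] (fun _ => 1) b := by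
    intro rev b
    rw [pullStep_one_iterate, pullStep_one_iterate, GrowsAt]
    have : tailMorphism (fun b => orient rev (φ b)) (Returns φ s) =
        tailMorphism (fun b => orient rev (φ b)) fun c => g c ≠ 0 := by
      congr 1
      exact hG.symm
    rw [this]
  rw [almostPeriodic_iff_not_growsAt hs hφ, pullStep_zero_iterate]
  simp only [List.sum_eq_zero_iff, List.mem_map, forall_exists_index, and_imp,
    forall_apply_eq_imp_iff₂, Fintype.card_fin]
  refine forall₂_congr fun b _ => ?_
  have h1 := hgrow false b
  have h2 := hgrow true b
  have h3 := hmono false b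
  have h4 := hmono true b
  change ¬ GrowsAt (tailMorphism (fun b => orient false (φ b)) (Returns φ s)) n b ∧
    ¬ GrowsAt (tailMorphism (fun b => orient true (φ b)) (Returns φ s)) n b ↔ _
  rw [h1, h2]
  omega

theorem phaseTime_le {n k N : ℕ} (hN : 1 ≤ N) (hn : n ≤ N) (hk : k ≤ N) :
    4 * phaseTime n k + n * 30 + 33 ≤ 400 * N ^ 3 := by
  -- Here n + 1 ≤ 2N, 12k + 11 ≤ 23N and 8 ≤ 8N². The total is then at most 4(62N³ + 3) + 30N + 33 ≤
  -- 323N³.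
  have h : phaseTime n k ≤ (2 * N) * (N * (23 * N) + 8 * (N * N)) + 3 := by
    unfold phaseTime
    gcongr
    · omega
    · omega
    · nlinarith
  have h1 : N ≤ N ^ 3 := Nat.le_self_pow (by omega) N
  have h2 : (2 * N) * (N * (23 * N) + 8 * (N * N)) = 62 * N ^ 3 := by ring
  omega

end Correctness
end PureMorphic

theorem mainTheorem4 :
    ∃ (P : PureMorphic.Cmd) (c d : ℕ),
      ∀ (n : ℕ) (φ : Fin n → List (Fin n)) (s : Fin n),
        PureMorphic.NonErasing φ → PureMorphic.Prolongable φ s →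
          ∃ (τ : PureMorphic.State) (t : ℕ),
            PureMorphic.Exec P (PureMorphic.initState (PureMorphic.encode φ s)) τ t ∧
            t ≤ c * (n + PureMorphic.maxImageLength φ) ^ d ∧
            (PureMorphic.AlmostPeriodic (PureMorphic.limitWord φ s) → τ.reg 0 = 1) ∧
            (¬ PureMorphic.AlmostPeriodic (PureMorphic.limitWord φ s) → τ.reg 0 = 0) := by
  refine ⟨PureMorphic.decider, 400, 3, fun n φ s hφ hs => ?_⟩
  have hn := s.isLt
  obtain ⟨τ, t, he, ht, hτ⟩ := PureMorphic.runs_decider (s := s)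
    (k := PureMorphic.maxImageLength φ)
    (fun b => Finset.le_sup (f := fun b => (φ b).length) (Finset.mem_univ b)) rfl
  have hiff := PureMorphic.almostPeriodic_iff_answer_eq_zero hφ hs rfl
  refine ⟨τ, t, he, ht.trans (PureMorphic.phaseTime_le (by omega) (by omega) (by omega)), ?_, ?_⟩
  · intro h
    rw [hτ, hiff.mp h]
  · intro h
    rw [hτ]
    exact Nat.sub_eq_zero_of_le (Nat.pos_of_ne_zero (mt hiff.mpr h))
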